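/- Let $q$ be an indeterminate. Write $[s]=(1-q^s)/(1-q)$ for an integer $s$, $(x;p)_0=1$ and $(x;p)_k=(1-x)(1-xp)\cdots(1-xp^{k-1})$ for $k\ge 1$, and let $\Phi_n(q)$ be the $n$-th cyclotomic polynomial. For rational functions $A,B\in\mathbb{Q}(q)$ and a polynomial $P\in\mathbb{Q}[q]$, $A\equiv B\pmod{P}$ means that the numerator of $A-B$, written in lowest terms, is divisible by $P$. Let $d,m,n,r$ be positive integers with $n\ge r$, $n\equiv r\pmod d$, $\gcd(r,d)=1$ and $d\ge m\ge 2$, and for $k\ge 0$ let $$\theta_q(k)=[2dk+r]\frac{(q^r;q^d)_k^6}{(q^d;q^d)_k^6}\,q^{(2d-3r)k}.$$ Then, modulo $\Phi_n(q)^6$, $$\begin{aligned} \sum_{\substack{i_1,\dots,i_m\ge 0\\ i_1+\cdots+i_m\le n-1}}\theta_q(i_1)\cdots\theta_q(i_m) \equiv{}&[n]^m q^{mr(r-n)/d}\frac{(q^{2r};q^d)_{(n-r)/d}^m}{(q^d;q^d)_{(n-r)/d}^m} \left\{\sum_{k=0}^{(n-r)/d}\frac{(q^r;q^d)_k^3(q^{d-r};q^d)_k}{(q^d;q^d)_k^3(q^{2r};q^d)_k}q^{dk}\right\}^{m-1}\\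 &\times\sum_{k=0}^{(n-r)/d}\frac{(q^r;q^d)_k^3(q^{d-r};q^d)_k}{(q^d;q^d)_k^3(q^{2r};q^d)_k}q^{dk} \left\{1-m(2-q^n)[n]^2\sum_{t=1}^{k}\left(\frac{q^{dt-d+r}}{[dt-d+r]^2}+\frac{q^{dt}}{[dt]^2}\right)\right\}. \end{aligned}$$ -/

import Mathlib

open Finset

namespace QSuper

noncomputable section

/-- The indeterminate `q` of the field `ℚ(q)` of rational functions. -/
def q : RatFunc ℚ := RatFunc.X

/-- The `q`-integer `[s] = (1 - q^s) / (1 - q)`. -/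
def qInt (s : ℤ) : RatFunc ℚ := (1 - q ^ s) / (1 - q)

/-- The `q`-shifted factorial `(x; p)_k = (1 - x) (1 - x p) ⋯ (1 - x p^(k-1))`, with base `p`. -/
def qPoch (x p : RatFunc ℚ) (k : ℕ) : RatFunc ℚ := ∏ j ∈ range k, (1 - x * p ^ j)

/-- Congruence of rational functions modulo a polynomial `P`: the numerator of `A - B`,
written in lowest terms, is divisible by `P`. -/
def RatCongr (P : Polynomial ℚ) (A B : RatFunc ℚ) : Prop := P ∣ (A - B).num

/-- `θ_q(k) = [2dk+r] (q^r;q^d)_k^6 / (q^d;q^d)_k^6 * q^((2d-3r)k)`. -/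
def theta (d r k : ℕ) : RatFunc ℚ :=
  qInt (2 * d * k + r) * (qPoch (q ^ r) (q ^ d) k ^ 6 / qPoch (q ^ d) (q ^ d) k ^ 6) *
    q ^ ((2 * (d : ℤ) - 3 * (r : ℤ)) * (k : ℤ))

/-- The sum of `θ_q(i_1) ⋯ θ_q(i_m)` over all `m`-tuples of nonnegative integers with
`i_1 + ⋯ + i_m ≤ n - 1` (every entry of such a tuple is less than `n` when `0 < n`). -/
def multiSum (d m n r : ℕ) : RatFunc ℚ :=
  ∑ i ∈ (Fintype.piFinset fun _ : Fin m => range n) with ∑ j, i j ≤ n - 1,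
    ∏ j, theta d r (i j)

/-- The summand `(q^r;q^d)_k^3 (q^(d-r);q^d)_k / ((q^d;q^d)_k^3 (q^(2r);q^d)_k) * q^(dk)`. -/
def term (d r k : ℕ) : RatFunc ℚ :=
  (qPoch (q ^ r) (q ^ d) k ^ 3 * qPoch (q ^ ((d : ℤ) - (r : ℤ))) (q ^ d) k) /
      (qPoch (q ^ d) (q ^ d) k ^ 3 * qPoch (q ^ (2 * r)) (q ^ d) k) *
    q ^ (d * k)

/-- The factor
`1 - m (2 - q^n) [n]^2 ∑_{t=1}^k (q^(dt-d+r) / [dt-d+r]^2 + q^(dt) / [dt]^2)`. -/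
def corr (d m n r k : ℕ) : RatFunc ℚ :=
  1 - (m : RatFunc ℚ) * (2 - q ^ n) * qInt n ^ 2 *
    ∑ t ∈ Icc 1 k,
      (q ^ ((d : ℤ) * t - d + r) / qInt ((d : ℤ) * t - d + r) ^ 2 +
        q ^ (d * t) / qInt ((d : ℤ) * t) ^ 2)

end

end QSuper

/-! Write a = q^r, p = q^d, N = (n-r)/d and t = q^n = a p^N. The parameter e = (1-t)^2/t is
divisible by Φ_n^2, and (1-xt)(1-x/t) = (1-x)^2 - ex. Pairing this with the conjugate quadratic
(1-x)^2 + ex gives (1-x)^4 - e^2 x^2, so replacing four of the six equal factors in θ_q by such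
pairs changes θ_q only at order e^2, that is Φ_n^4. The deformed sum over k ≤ N is a terminating
very-well-poised series, and Watson's transformation (`q_watson`, `theta_watson`) turns it into [n]
times a balanced series whose expansion to first order in e gives the correction term.

One more power of Φ_n comes from symmetry: under k ↦ N-k, θ_q is odd modulo Φ_n while the
coefficient of e^2 is even, so the e^2 contribution vanishes modulo Φ_n^5 (`sum_theta_mul_mem`).
Hence the single sum is known modulo Φ_n^5 (`sum_theta_sub_mem`).

The multiple sum is the m-th power of the single sum modulo Φ_n^6: an index above N contributes
Φ_n^6, and tuples with all entries at most N satisfy the sum condition because m ≤ d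
(`multiSum_sub_mem`). The single sum is divisible by Φ_n, so its m-th power is determined modulo
Φ_n^(4+m), which suffices as m ≥ 2. -/

namespace QSuper

/-! ### Watson's transformation by telescoping. -/

section Watson

variable {K : Type*} [Field K]

/-- The `q`-shifted factorial over an arbitrary field. -/
def poch (x p : K) (k : ℕ) : K := ∏ j ∈ range k, (1 - x * p ^ j)

/-- The product `(p^(-k); p)_j (a p^k; p)_j`. -/
def nodeProd (a p : K) (k j : ℕ) : K :=
  ∏ i ∈ range j, ((1 - p ^ i / p ^ k) * (1 - a * p ^ k * p ^ i))

/-- The quadratic `(1 - x)^2 + e x`. -/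
def quad (e x : K) : K := (1 - x) ^ 2 + e * x

/-- The product of the quadratics at `x, x p, …, x p^(k-1)`. -/
def quadProd (e x p : K) (k : ℕ) : K := ∏ j ∈ range k, quad e (x * p ^ j)

lemma poch_succ (x p : K) (k : ℕ) : poch x p (k + 1) = poch x p k * (1 - x * p ^ k) :=
  prod_range_succ _ _

lemma quadProd_succ (e x p : K) (k : ℕ) :
    quadProd e x p (k + 1) = quadProd e x p k * quad e (x * p ^ k) :=
  prod_range_succ _ _

lemma nodeProd_succ (a p : K) (k j : ℕ) :
    nodeProd a p k (j + 1) =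
      nodeProd a p k j * ((1 - p ^ j / p ^ k) * (1 - a * p ^ k * p ^ j)) :=
  prod_range_succ _ _

lemma nodeProd_eq_zero (a p : K) (hp : p ≠ 0) {k j : ℕ} (h : k < j) : nodeProd a p k j = 0 := by
  apply prod_eq_zero (mem_range.2 h)
  rw [div_self (pow_ne_zero _ hp)]; ring

lemma nodeProd_step (a p : K) (hp : p ≠ 0) (k j : ℕ) :
    (1 - p ^ j / p ^ (k + 1)) * (1 - a * p ^ k) * nodeProd a p (k + 1) j =
      (1 - 1 / p ^ (k + 1)) * (1 - a * p ^ k * p ^ j) * nodeProd a p k j := by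
  induction j with
  | zero => simp [nodeProd]
  | succ j ih =>
    rw [nodeProd_succ, nodeProd_succ]
    have e1 : (1 : K) - p ^ (j + 1) / p ^ (k + 1) = 1 - p ^ j / p ^ k := by
      rw [pow_succ, pow_succ, mul_div_mul_right _ _ hp]
    have e2 : 1 - a * p ^ (k + 1) * p ^ j = 1 - a * p ^ k * p ^ (j + 1) := by ring
    rw [e1, e2]
    linear_combination (1 - p ^ j / p ^ k) * (1 - a * p ^ k * p ^ (j + 1)) * ih

lemma nodeProd_succ_succ (a p : K) (hp : p ≠ 0) (k j : ℕ) :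
    (1 - a * p ^ k) * nodeProd a p (k + 1) (j + 1) =
      (1 - 1 / p ^ (k + 1)) * (1 - a * p ^ k * p ^ j) * (1 - a * p ^ k * p ^ (j + 1)) *
        nodeProd a p k j := by
  rw [nodeProd_succ]
  linear_combination (1 - a * p ^ (k + 1) * p ^ j) * nodeProd_step a p hp k j

/-- The coefficients of the expansion in `q_saalschutz`. -/
def saalCoeff (a p e : K) (j : ℕ) : K :=
  poch (p / a) p j * p ^ j / (poch p p j * quadProd e p p j)

lemma saalCoeff_succ (a p e : K) (j : ℕ) :
    saalCoeff a p e (j + 1) = saalCoeff a p e j *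
      ((1 - p / a * p ^ j) * p / ((1 - p * p ^ j) * quad e (p * p ^ j))) := by
  simp only [saalCoeff, poch_succ, quadProd_succ, pow_succ]
  rw [div_mul_div_comm]; congr 1 <;> ring

/-- The right side is an explicit antidifference in J, so the induction step is a rational function
identity. Once J exceeds k the boundary term vanishes, leaving a first-order recurrence in k for the
expansion below. -/
lemma saal_telescope (a p e : K) (hp : p ≠ 0) (ha : a ≠ 0) (k J : ℕ)
    (hak : 1 - a * p ^ k ≠ 0) (h1 : ∀ j < J, 1 - p * p ^ j ≠ 0)
    (h2 : ∀ j < J, quad e (p * p ^ j) ≠ 0) :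
    ∑ j ∈ range (J + 1), (p / a * quad e (a * p ^ k) * saalCoeff a p e j * nodeProd a p k j -
        quad e (p * p ^ k) * saalCoeff a p e j * nodeProd a p (k + 1) j) =
      (a * p * (p ^ k) ^ 2 - 1) * saalCoeff a p e J / p ^ J * (1 - p / a * p ^ J) *
        nodeProd a p k J * (1 - a * p ^ k * p ^ J) / (1 - a * p ^ k) := by
  induction J with
  | zero =>
    simp [saalCoeff, nodeProd, poch, quadProd, quad]
    field_simp
    ring
  | succ J ih =>
    rw [sum_range_succ, ih (fun j hj => h1 j (by omega)) (fun j hj => h2 j (by omega))]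
    -- All node products are reduced to `nodeProd a p k J`, which then factors out.
    have e1 : nodeProd a p (k + 1) (J + 1) =
      (1 - 1 / p ^ (k + 1)) * (1 - a * p ^ k * p ^ J) * (1 - a * p ^ k * p ^ (J + 1)) *
        nodeProd a p k J / (1 - a * p ^ k) := by
      rw [eq_div_iff hak, ← nodeProd_succ_succ a p hp]; ring
    rw [e1, saalCoeff_succ, nodeProd_succ]
    have g1 := h1 J (by omega)
    have g2 := h2 J (by omega)
    have hpk := pow_ne_zero k hp
    have hpJ := pow_ne_zero J hp
    simp only [pow_succ]
    generalize p ^ k = x at *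
    generalize p ^ J = y at *
    generalize saalCoeff a p e J = c
    generalize nodeProd a p k J = w
    clear ih h1 h2 e1
    generalize hD : quad e (p * y) = D at *
    field_simp
    rw [← hD]
    simp only [quad]
    ring

/-- Both sides satisfy the same first-order recurrence in k. The point is to isolate the
k-dependence in node products, against which the well-poised sum can be evaluated. -/
theorem q_saalschutz (a p e : K) (hp : p ≠ 0) (ha : a ≠ 0) (k : ℕ)
    (hak : ∀ j < k, 1 - a * p ^ j ≠ 0) (h1 : ∀ j < k, 1 - p * p ^ j ≠ 0)
    (h2 : ∀ j < k, quad e (p * p ^ j) ≠ 0) :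
    quadProd e a p k / quadProd e p p k * (p / a) ^ k =
      ∑ j ∈ range (k + 1), saalCoeff a p e j * nodeProd a p k j := by
  induction k with
  | zero => simp [saalCoeff, nodeProd, poch, quadProd]
  | succ k ih =>
    have ih := ih (fun j hj => hak j (by omega)) (fun j hj => h1 j (by omega))
      (fun j hj => h2 j (by omega))
    -- The choice J = k + 1 reaches the last nonzero term for k + 1 and kills the boundary term
    -- through `nodeProd a p k (k + 1) = 0`.
    have T := saal_telescope a p e hp ha k (k + 1) (hak k (by omega)) h1 h2
    rw [nodeProd_eq_zero a p hp (Nat.lt_succ_self k)] at T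
    have g := h2 k (by omega)
    rw [sum_sub_distrib, sum_range_succ, nodeProd_eq_zero a p hp (Nat.lt_succ_self k)] at T
    simp only [mul_assoc, ← mul_sum] at T
    rw [← ih] at T
    rw [← mul_right_inj' g, quadProd_succ, quadProd_succ]
    have hq : quadProd e p p k ≠ 0 := prod_ne_zero_iff.2 fun j hj => h2 j (by
      have := mem_range.1 hj; omega)
    simp only [mul_zero, zero_mul, zero_div, add_zero] at T
    rw [sub_eq_zero] at T
    rw [← T, pow_succ]
    field_simp

/-- A very-well-poised summand without its factor `1 - a p^(2k)`. -/
def wellPoised (a p t : K) (k : ℕ) : K :=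
  poch a p k ^ 2 * poch (a * t) p k * poch (a / t) p k /
    (poch p p k ^ 2 * poch (p / t) p k * poch (p * t) p k) * (p / a ^ 2) ^ k

lemma wellPoised_succ (a p t : K) (k : ℕ) :
    wellPoised a p t (k + 1) = wellPoised a p t k *
      ((1 - a * p ^ k) ^ 2 * (1 - a * t * p ^ k) * (1 - a / t * p ^ k) /
        ((1 - p * p ^ k) ^ 2 * (1 - p / t * p ^ k) * (1 - p * t * p ^ k)) * (p / a ^ 2)) := by
  simp only [wellPoised, poch_succ, pow_succ]
  refine Eq.trans ?_ (mul_mul_mul_comm _ _ _ _).symm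
  rw [div_mul_div_comm]
  congr 2 <;> ring

/-- Again an explicit antidifference, now in the summation index k. The first product in the bracket
raises j by one in the node product, so this is a recurrence in j. -/
lemma wellPoised_telescope (a p t : K) (hp : p ≠ 0) (ha : a ≠ 0) (ht : t ≠ 0) (j M : ℕ)
    (hak : ∀ k < M, 1 - a * p ^ k ≠ 0) (h1 : ∀ k < M, 1 - p * p ^ k ≠ 0)
    (h2 : ∀ k < M, 1 - p / t * p ^ k ≠ 0) (h3 : ∀ k < M, 1 - p * t * p ^ k ≠ 0) :
    ∑ k ∈ range (M + 1), wellPoised a p t k * (1 - a * (p ^ k) ^ 2) * nodeProd a p k j *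
        ((1 - p ^ j / p ^ k) * (1 - a * p ^ k * p ^ j) * (1 - a ^ 2 * p ^ j) -
          (1 - a * t * p ^ j) * (1 - a * p ^ j) * (1 - a / t * p ^ j)) =
      -(p ^ j / p ^ M) * wellPoised a p t M * nodeProd a p M j * (1 - a * p ^ M) *
        (1 - a * t * p ^ M) * (1 - a / t * p ^ M) * (1 - a * p ^ M * p ^ j) := by
  induction M with
  | zero =>
    cases j with
    | zero =>
      simp [wellPoised, nodeProd, poch]
      field_simp
      ring
    | succ j =>
      rw [sum_range_one, nodeProd_eq_zero a p hp (Nat.succ_pos j)]; ring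
  | succ M ih =>
    rw [sum_range_succ, ih (fun j hj => hak j (by omega)) (fun j hj => h1 j (by omega))
      (fun j hj => h2 j (by omega)) (fun j hj => h3 j (by omega))]
    have e1 := nodeProd_step a p hp M j
    rw [wellPoised_succ]
    have g0 := hak M (by omega)
    have g1 := h1 M (by omega)
    have g2 := h2 M (by omega)
    have g3 := h3 M (by omega)
    have hpM := pow_ne_zero M hp
    have hpj := pow_ne_zero j hp
    have e2 : (1 - a * p ^ M * p ^ j) * nodeProd a p M j = (p * p ^ M - p ^ j) * (1 - a * p ^ M) *
        nodeProd a p (M + 1) j / (p * p ^ M - 1) := by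
      have : p * p ^ M - 1 ≠ 0 := fun h => g1 (by linear_combination -h)
      rw [eq_div_iff this]
      simp only [pow_succ] at e1
      field_simp at e1
      linear_combination -e1
    have e3 : -(p ^ j / p ^ M) * wellPoised a p t M * nodeProd a p M j * (1 - a * p ^ M) *
        (1 - a * t * p ^ M) * (1 - a / t * p ^ M) * (1 - a * p ^ M * p ^ j) =
        -(p ^ j / p ^ M) * wellPoised a p t M * (1 - a * p ^ M) *
        (1 - a * t * p ^ M) * (1 - a / t * p ^ M) *
        ((1 - a * p ^ M * p ^ j) * nodeProd a p M j) := by ring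
    rw [e3, e2]
    have g1' : p * p ^ M - 1 ≠ 0 := fun h => g1 (by linear_combination -h)
    simp only [pow_succ p M]
    generalize p ^ M = x at *
    generalize p ^ j = y at *
    generalize nodeProd a p (M + 1) j = w
    generalize wellPoised a p t M = c
    have g2' : t - p * x ≠ 0 := fun h => g2 (by field_simp; simpa using h)
    have : (1 - p * x) = -(p * x - 1) := by ring
    rw [this]
    clear ih hak h1 h2 h3 e1 e2 e3
    have g2e : 1 - p / t * x = (t - p * x) / t := by field_simp
    rw [g2e]
    generalize hD1 : p * x - 1 = D1 at *
    generalize hD2 : t - p * x = D2 at *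
    generalize hD3 : 1 - p * t * x = D3 at *
    field_simp
    rw [← hD1, ← hD2, ← hD3]
    ring

/-- Terminating very-well-poised sums, up to their dependence on `j`. -/
def nodeSum (a p t : K) (N j : ℕ) : K :=
  ∑ k ∈ range (N + 1), wellPoised a p t k * (1 - a * (p ^ k) ^ 2) * nodeProd a p k j

/-- Since t = a p^N, the factor 1 - (a/t) p^N of the boundary term is zero. -/
lemma nodeSum_succ (a p t : K) (hp : p ≠ 0) (ha : a ≠ 0) (ht : t ≠ 0) (N j : ℕ)
    (hN : a * p ^ N = t) (hak : ∀ k < N, 1 - a * p ^ k ≠ 0) (h1 : ∀ k < N, 1 - p * p ^ k ≠ 0)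
    (h2 : ∀ k < N, 1 - p / t * p ^ k ≠ 0) (h3 : ∀ k < N, 1 - p * t * p ^ k ≠ 0) :
    nodeSum a p t N (j + 1) * (1 - a ^ 2 * p ^ j) = nodeSum a p t N j *
      ((1 - a * t * p ^ j) * (1 - a * p ^ j) * (1 - a / t * p ^ j)) := by
  have T := wellPoised_telescope a p t hp ha ht j N hak h1 h2 h3
  have e : 1 - a / t * p ^ N = 0 := by rw [div_mul_eq_mul_div, hN, div_self ht, sub_self]
  rw [e] at T
  rw [nodeSum, nodeSum, sum_mul, sum_mul, ← sub_eq_zero, ← sum_sub_distrib]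
  refine Eq.trans (sum_congr rfl fun k _ => ?_) (T.trans (by ring))
  rw [nodeProd_succ]; ring

lemma nodeSum_mul_poch (a p t : K) (hp : p ≠ 0) (ha : a ≠ 0) (ht : t ≠ 0) (N j : ℕ)
    (hN : a * p ^ N = t) (hak : ∀ k < N, 1 - a * p ^ k ≠ 0) (h1 : ∀ k < N, 1 - p * p ^ k ≠ 0)
    (h2 : ∀ k < N, 1 - p / t * p ^ k ≠ 0) (h3 : ∀ k < N, 1 - p * t * p ^ k ≠ 0) :
    nodeSum a p t N j * poch (a ^ 2) p j = nodeSum a p t N 0 *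
      (poch (a * t) p j * poch a p j * poch (a / t) p j) := by
  induction j with
  | zero => simp [poch]
  | succ j ih =>
    have := nodeSum_succ a p t hp ha ht N j hN hak h1 h2 h3
    simp only [poch_succ]
    linear_combination poch (a ^ 2) p j * this +
      ((1 - a * t * p ^ j) * (1 - a * p ^ j) * (1 - a / t * p ^ j)) * ih

lemma poch_ne_zero {x p : K} {k : ℕ} (h : ∀ j < k, 1 - x * p ^ j ≠ 0) : poch x p k ≠ 0 :=
  prod_ne_zero_iff.2 fun j hj => h j (mem_range.1 hj)

lemma poch_shift (x p : K) (k : ℕ) :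
    (1 - x) * poch (p * x) p k = poch x p k * (1 - x * p ^ k) := by
  rw [← poch_succ, poch, poch, prod_range_succ']
  simp only [pow_zero, mul_one, mul_comm (1 - x)]
  congr 1
  refine prod_congr rfl fun j _ => ?_
  ring

/-- Reverse the product and use 1 - 1/x = (1 - x)(-1/x). -/
lemma poch_div_last (a p : K) (hp : p ≠ 0) (ha : a ≠ 0) (N : ℕ) :
    poch (p / (a * p ^ N)) p N = poch a p N * ∏ i ∈ range N, (-1 / (a * p ^ i)) := by
  rw [poch, poch, ← prod_mul_distrib]
  refine (prod_range_reflect _ _).symm.trans (prod_congr rfl fun j hj => ?_)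
  have hj := mem_range.1 hj
  obtain ⟨i, rfl⟩ : ∃ i, N = j + 1 + i := ⟨N - (j + 1), by omega⟩
  have : j + 1 + i - 1 - j = i := by omega
  rw [this]
  field_simp
  ring

lemma nodeProd_self (a p : K) (hp : p ≠ 0) (N : ℕ) :
    nodeProd a p N N = poch p p N * (∏ i ∈ range N, (-1 / (p * p ^ i))) *
      poch (a * p ^ N) p N := by
  rw [nodeProd, prod_mul_distrib]
  congr 1
  rw [poch, ← prod_mul_distrib]
  refine (prod_range_reflect _ _).symm.trans (prod_congr rfl fun j hj => ?_)
  have hj := mem_range.1 hj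
  obtain ⟨i, rfl⟩ : ∃ i, N = j + 1 + i := ⟨N - (j + 1), by omega⟩
  have : j + 1 + i - 1 - j = i := by omega
  rw [this]
  field_simp
  ring

lemma nodeSum_self (a p t : K) (hp : p ≠ 0) (N : ℕ) :
    nodeSum a p t N N =
      wellPoised a p t N * (1 - a * (p ^ N) ^ 2) * nodeProd a p N N := by
  rw [nodeSum, sum_range_succ, sum_eq_zero, zero_add]
  intro k hk
  rw [nodeProd_eq_zero a p hp (mem_range.1 hk), mul_zero]

/-- At j = N only the summand k = N survives, so the sum is explicit there; the recurrence in j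
carries this value back to j = 0. -/
lemma nodeSum_zero (a p t : K) (hp : p ≠ 0) (ha : a ≠ 0) (ht : t ≠ 0) (N : ℕ)
    (hN : a * p ^ N = t)
    (hak : ∀ k < N, 1 - a * p ^ k ≠ 0) (h1 : ∀ k < N, 1 - p * p ^ k ≠ 0)
    (h2 : ∀ k < N, 1 - p / t * p ^ k ≠ 0) (h3 : ∀ k < N, 1 - p * t * p ^ k ≠ 0)
    (h4 : ∀ k < N, 1 - a * t * p ^ k ≠ 0) (h5 : ∀ k < N, 1 - a / t * p ^ k ≠ 0) :
    nodeSum a p t N 0 = (1 - t) * (poch (a ^ 2) p N / poch p p N) / a ^ N := by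
  have T := nodeSum_mul_poch a p t hp ha ht N N hN hak h1 h2 h3
  have e1 := poch_shift t p N
  have e2 : 1 - a * (p ^ N) ^ 2 = 1 - t * p ^ N := by rw [← hN]; ring
  rw [nodeSum_self a p t hp, nodeProd_self a p hp, wellPoised, e2] at T
  have e3 := poch_div_last a p hp ha N
  have na := poch_ne_zero hak
  have n1 := poch_ne_zero h1
  have n2 := poch_ne_zero h2
  have n3 := poch_ne_zero h3
  have n4 := poch_ne_zero h4
  have n5 := poch_ne_zero h5
  have e4 : ∏ i ∈ range N, (-1 / (p * p ^ i)) =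
      (∏ i ∈ range N, (-1 / (a * p ^ i))) * (a / p) ^ N := by
    rw [← card_range N, ← prod_const, card_range, ← prod_mul_distrib]
    refine prod_congr rfl fun i _ => ?_
    field_simp
  rw [hN] at e3 T
  rw [e4] at T
  rw [e3] at T n2
  have nz := right_ne_zero_of_mul n2
  rw [div_pow, div_pow, ← pow_mul] at T
  have hpN := pow_ne_zero N hp
  have haN := pow_ne_zero N ha
  have h2N : a ^ (2 * N) = a ^ N * a ^ N := by rw [two_mul, pow_add]
  rw [h2N] at T
  have key : poch t p N * (1 - t * p ^ N) = (1 - t) * poch (p * t) p N := e1.symm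
  generalize poch t p N = Pt at *
  have T2 := mul_right_cancel₀ (b := poch (a * t) p N * poch a p N * poch (a / t) p N)
    (by simp [na, n4, n5]) (T.symm.trans (b := _)
      (c := ((1 - t) * (poch (a ^ 2) p N / poch p p N) / a ^ N) *
        (poch (a * t) p N * poch a p N * poch (a / t) p N)) ?_)
  · exact T2
  · generalize ∏ i ∈ range N, (-1 / (a * p ^ i)) = Z at *
    generalize hX : 1 - t * p ^ N = X at *
    generalize poch (p * t) p N = P3 at *
    field_simp
    linear_combination poch (a ^ 2) p N * key

/-- Watson's transformation of a terminating very-well-poised series, specialised. -/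
theorem q_watson (a p t e : K) (hp : p ≠ 0) (ha : a ≠ 0) (ht : t ≠ 0) (N : ℕ)
    (hN : a * p ^ N = t)
    (hak : ∀ k < N, 1 - a * p ^ k ≠ 0) (h1 : ∀ k < N, 1 - p * p ^ k ≠ 0)
    (h2 : ∀ k < N, 1 - p / t * p ^ k ≠ 0) (h3 : ∀ k < N, 1 - p * t * p ^ k ≠ 0)
    (h4 : ∀ k < N, 1 - a * t * p ^ k ≠ 0) (h5 : ∀ k < N, 1 - a / t * p ^ k ≠ 0)
    (h6 : ∀ k < N, 1 - a ^ 2 * p ^ k ≠ 0) (h7 : ∀ k < N, quad e (p * p ^ k) ≠ 0) :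
    ∑ k ∈ range (N + 1), wellPoised a p t k * (1 - a * (p ^ k) ^ 2) *
        (quadProd e a p k / quadProd e p p k * (p / a) ^ k) =
      (1 - t) * (poch (a ^ 2) p N / poch p p N) / a ^ N *
        ∑ j ∈ range (N + 1), saalCoeff a p e j *
          (poch (a * t) p j * poch a p j * poch (a / t) p j / poch (a ^ 2) p j) := by
  rw [← nodeSum_zero a p t hp ha ht N hN hak h1 h2 h3 h4 h5, mul_sum]
  have : ∀ j ∈ range (N + 1), nodeSum a p t N 0 * (saalCoeff a p e j *
      (poch (a * t) p j * poch a p j * poch (a / t) p j / poch (a ^ 2) p j)) =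
      ∑ k ∈ range (N + 1), wellPoised a p t k * (1 - a * (p ^ k) ^ 2) *
        (saalCoeff a p e j * nodeProd a p k j) := by
    intro j hj
    have hj := mem_range.1 hj
    have n6 : poch (a ^ 2) p j ≠ 0 := poch_ne_zero fun i hi => h6 i (by omega)
    have e1 := nodeSum_mul_poch a p t hp ha ht N j hN hak h1 h2 h3
    rw [← eq_div_iff n6] at e1
    have e2 : nodeSum a p t N 0 * (saalCoeff a p e j *
      (poch (a * t) p j * poch a p j * poch (a / t) p j / poch (a ^ 2) p j)) =
      saalCoeff a p e j * nodeSum a p t N j := by rw [e1]; ring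
    rw [e2, nodeSum, mul_sum]
    exact sum_congr rfl fun k _ => by ring
  -- After the interchange, the inner sum over j is the expansion of `q_saalschutz`; its terms with
  -- j > k vanish.
  rw [sum_congr rfl this, sum_comm]
  refine sum_congr rfl fun k hk => ?_
  have hk := mem_range.1 hk
  rw [q_saalschutz a p e hp ha k (fun j hj => hak j (by omega)) (fun j hj => h1 j (by omega))
    (fun j hj => h7 j (by omega)), ← mul_sum]
  congr 1
  refine sum_subset (range_subset_range.2 (by omega)) fun j _ hj => ?_
  rw [nodeProd_eq_zero a p hp (by rw [mem_range] at hj; omega), mul_zero]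

end Watson

/-! ### Congruences in the localization of ℚ[q] at P. -/

section LocalRing

open Polynomial

/-- The rational functions that have a representation with denominator prime to `P`. -/
noncomputable def localRing (P : ℚ[X]) : Subring (RatFunc ℚ) where
  carrier := {x | ∃ a b : ℚ[X], IsCoprime P b ∧ b ≠ 0 ∧
    x * algebraMap ℚ[X] (RatFunc ℚ) b = algebraMap ℚ[X] (RatFunc ℚ) a}
  mul_mem' := by
    rintro x y ⟨a, b, hb, hb0, h⟩ ⟨c, d, hd, hd0, h'⟩
    refine ⟨a * c, b * d, hb.mul_right hd, mul_ne_zero hb0 hd0, ?_⟩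
    rw [map_mul, map_mul, ← h, ← h']; ring
  add_mem' := by
    rintro x y ⟨a, b, hb, hb0, h⟩ ⟨c, d, hd, hd0, h'⟩
    refine ⟨a * d + c * b, b * d, hb.mul_right hd, mul_ne_zero hb0 hd0, ?_⟩
    rw [map_add, map_mul, map_mul, map_mul, ← h, ← h']; ring
  neg_mem' := by
    rintro x ⟨a, b, hb, hb0, h⟩
    exact ⟨-a, b, hb, hb0, by rw [map_neg, ← h]; ring⟩
  one_mem' := ⟨1, 1, isCoprime_one_right, one_ne_zero, by simp⟩
  zero_mem' := ⟨0, 1, isCoprime_one_right, one_ne_zero, by simp⟩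

/-- The powers of the ideal generated by `P` in the local ring at `P`. -/
noncomputable def powIdeal (P : ℚ[X]) (e : ℕ) : AddSubgroup (RatFunc ℚ) :=
  (localRing P).toAddSubgroup.map
    (AddMonoidHom.mulLeft (algebraMap ℚ[X] (RatFunc ℚ) P ^ e))

variable {P : ℚ[X]} {e f : ℕ} {x y x' y' : RatFunc ℚ}

lemma mem_powIdeal : x ∈ powIdeal P e ↔
    ∃ z ∈ localRing P, algebraMap ℚ[X] (RatFunc ℚ) P ^ e * z = x := Iff.rfl

lemma algebraMap_mem_localRing (a : ℚ[X]) : algebraMap ℚ[X] (RatFunc ℚ) a ∈ localRing P :=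
  ⟨a, 1, isCoprime_one_right, one_ne_zero, by simp⟩

lemma inv_algebraMap_mem_localRing {b : ℚ[X]} (h : IsCoprime P b) (hb : b ≠ 0) :
    (algebraMap ℚ[X] (RatFunc ℚ) b)⁻¹ ∈ localRing P :=
  ⟨1, b, h, hb, by rw [map_one, inv_mul_cancel₀]; simpa using hb⟩

lemma mem_powIdeal_zero : x ∈ powIdeal P 0 ↔ x ∈ localRing P := by
  simp [mem_powIdeal]

lemma mul_mem_powIdeal (hx : x ∈ powIdeal P e) (hy : y ∈ powIdeal P f) :
    x * y ∈ powIdeal P (e + f) := by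
  obtain ⟨z, hz, rfl⟩ := mem_powIdeal.1 hx
  obtain ⟨w, hw, rfl⟩ := mem_powIdeal.1 hy
  exact ⟨z * w, (localRing P).mul_mem hz hw, by simp; ring⟩

lemma powIdeal_mono (h : f ≤ e) (hx : x ∈ powIdeal P e) : x ∈ powIdeal P f := by
  obtain ⟨z, hz, rfl⟩ := mem_powIdeal.1 hx
  obtain ⟨g, rfl⟩ := Nat.exists_eq_add_of_le h
  exact ⟨algebraMap ℚ[X] (RatFunc ℚ) P ^ g * z,
    (localRing P).mul_mem (pow_mem (algebraMap_mem_localRing P) g) hz, by simp; ring⟩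

lemma powIdeal_le_localRing (hx : x ∈ powIdeal P e) : x ∈ localRing P :=
  mem_powIdeal_zero.1 (powIdeal_mono (Nat.zero_le e) hx)

lemma mul_mem_powIdeal_left (hx : x ∈ localRing P) (hy : y ∈ powIdeal P e) :
    x * y ∈ powIdeal P e := by
  simpa using mul_mem_powIdeal (mem_powIdeal_zero.2 hx) hy

lemma mul_mem_powIdeal_right (hx : x ∈ powIdeal P e) (hy : y ∈ localRing P) :
    x * y ∈ powIdeal P e := by
  simpa using mul_mem_powIdeal hx (mem_powIdeal_zero.2 hy)

lemma pow_mem_powIdeal (hx : x ∈ powIdeal P e) (k : ℕ) : x ^ k ∈ powIdeal P (e * k) := by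
  induction k with
  | zero => simpa using mem_powIdeal_zero.2 (one_mem (localRing P))
  | succ k ih => simpa [pow_succ, Nat.mul_succ] using mul_mem_powIdeal ih hx

lemma mul_sub_mul_mem (hx : x - x' ∈ powIdeal P e) (hy : y - y' ∈ powIdeal P e)
    (hx' : x ∈ localRing P) (hy' : y' ∈ localRing P) : x * y - x' * y' ∈ powIdeal P e := by
  have : x * y - x' * y' = x * (y - y') + (x - x') * y' := by ring
  rw [this]
  exact add_mem (mul_mem_powIdeal_left hx' hy) (mul_mem_powIdeal_right hx hy')

lemma prod_sub_prod_mem {ι : Type*} (s : Finset ι) (g h : ι → RatFunc ℚ)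
    (hg : ∀ i ∈ s, g i ∈ localRing P) (hh : ∀ i ∈ s, h i ∈ localRing P)
    (hgh : ∀ i ∈ s, g i - h i ∈ powIdeal P e) : ∏ i ∈ s, g i - ∏ i ∈ s, h i ∈ powIdeal P e := by
  classical
  induction s using Finset.induction_on with
  | empty => simp [zero_mem]
  | insert i s hi ih =>
    rw [prod_insert hi, prod_insert hi]
    refine mul_sub_mul_mem (hgh i (mem_insert_self i s))
      (ih (fun j hj => hg j (mem_insert_of_mem hj)) (fun j hj => hh j (mem_insert_of_mem hj))
        (fun j hj => hgh j (mem_insert_of_mem hj)))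
      (hg i (mem_insert_self i s)) (prod_mem fun j hj => hh j (mem_insert_of_mem hj))

lemma pow_sub_pow_mem (h : x - y ∈ powIdeal P e) (hx : x ∈ localRing P) (hy : y ∈ localRing P)
    (k : ℕ) : x ^ k - y ^ k ∈ powIdeal P e := by
  simpa using prod_sub_prod_mem (range k) (fun _ => x) (fun _ => y) (fun _ _ => hx)
    (fun _ _ => hy) (fun _ _ => h)

/-- If `x` and `y` are divisible by `P` and congruent modulo `P^(e+1)`, then their `m`-th powers
are congruent modulo `P^(e+m)`. -/
lemma pow_sub_pow_mem_of_dvd (hP : P ≠ 0) (h : x - y ∈ powIdeal P (e + 1))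
    (hx : x ∈ powIdeal P 1) (hy : y ∈ powIdeal P 1) (m : ℕ) :
    x ^ m - y ^ m ∈ powIdeal P (e + m) := by
  obtain ⟨z, hz, rfl⟩ := mem_powIdeal.1 hx
  obtain ⟨w, hw, rfl⟩ := mem_powIdeal.1 hy
  obtain ⟨v, hv, hzw⟩ := mem_powIdeal.1 h
  have hP' : algebraMap ℚ[X] (RatFunc ℚ) P ≠ 0 := by simpa using hP
  have h1 : z - w ∈ powIdeal P e := by
    refine ⟨v, hv, ?_⟩
    apply mul_left_cancel₀ hP'
    simp only [pow_one, AddMonoidHom.coe_mulLeft] at hzw ⊢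
    rw [mul_sub, ← hzw]; ring
  obtain ⟨u, hu, hu'⟩ := mem_powIdeal.1 (pow_sub_pow_mem h1 hz hw m)
  refine ⟨u, hu, ?_⟩
  simp only [pow_one, AddMonoidHom.coe_mulLeft, mul_pow]
  rw [← mul_sub, ← hu']; ring

/-- If x = P a / b, then 1 - x = (b - P a) / b, whose numerator is still prime to P. -/
lemma inv_one_sub_mem (hP : ¬ IsUnit P) (hx : x ∈ powIdeal P 1) :
    (1 - x)⁻¹ ∈ localRing P ∧ 1 - x ≠ 0 := by
  obtain ⟨z, ⟨a, b, hb, hb0, h⟩, rfl⟩ := mem_powIdeal.1 hx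
  have hc : IsCoprime P (b - P * a) := by
    simpa [sub_eq_add_neg] using hb.add_mul_left_right (-a)
  have hc0 : b - P * a ≠ 0 := by
    intro h0
    rw [h0, isCoprime_zero_right] at hc
    exact hP hc
  have hb1 : algebraMap ℚ[X] (RatFunc ℚ) b ≠ 0 := by simpa using hb0
  have hc1 : algebraMap ℚ[X] (RatFunc ℚ) (b - P * a) ≠ 0 :=
    RatFunc.algebraMap_ne_zero hc0
  have key : (1 - algebraMap ℚ[X] (RatFunc ℚ) P ^ 1 * z) * algebraMap ℚ[X] (RatFunc ℚ) b =
      algebraMap ℚ[X] (RatFunc ℚ) (b - P * a) := by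
    rw [map_sub, map_mul, ← h]; ring
  have hne : 1 - algebraMap ℚ[X] (RatFunc ℚ) P ^ 1 * z ≠ 0 := by
    intro h0; rw [h0, zero_mul] at key; exact hc1 key.symm
  refine ⟨⟨b, b - P * a, hc, hc0, ?_⟩, hne⟩
  rw [← key, inv_mul_cancel_left₀ hne]

/-- Clearing denominators, P^e divides the reduced numerator times b, and b is prime to P. -/
lemma ratCongr_of_mem (h : x - y ∈ powIdeal P e) : RatCongr (P ^ e) x y := by
  obtain ⟨z, ⟨a, b, hb, hb0, h1⟩, h2⟩ := mem_powIdeal.1 h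
  have hd : algebraMap ℚ[X] (RatFunc ℚ) (x - y).denom ≠ 0 := by
    simpa using (x - y).denom_ne_zero
  have h3 : algebraMap ℚ[X] (RatFunc ℚ) (x - y).num =
      (x - y) * algebraMap ℚ[X] (RatFunc ℚ) (x - y).denom := by
    rw [← div_eq_iff hd, RatFunc.num_div_denom]
  have h4 : (x - y).num * b = P ^ e * (a * (x - y).denom) := by
    apply RatFunc.algebraMap_injective ℚ
    rw [map_mul, h3, ← h2, map_mul, map_mul, map_pow, ← h1]
    ring
  exact (hb.pow_left).dvd_of_dvd_mul_right (Dvd.intro _ h4.symm)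

/-- First order expansion of a quotient of products of factors close to `1`. -/
lemma prod_div_sub_mem (hP : ¬ IsUnit P) (he : 1 ≤ e) (k : ℕ) (u v : ℕ → RatFunc ℚ)
    (hu : ∀ j < k, u j ∈ powIdeal P e) (hv : ∀ j < k, v j ∈ powIdeal P e) :
    ∏ j ∈ range k, (1 - u j) / (1 - v j) - (1 - ∑ j ∈ range k, (u j - v j)) ∈
      powIdeal P (2 * e) := by
  induction k with
  | zero => simp [zero_mem]
  | succ k ih =>
    have ih := ih (fun j hj => hu j (by omega)) (fun j hj => hv j (by omega))
    have hu1 := hu k (by omega)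
    have hv1 := hv k (by omega)
    obtain ⟨i1, i2⟩ := inv_one_sub_mem hP (powIdeal_mono he hv1)
    rw [prod_range_succ, sum_range_succ]
    have hS : ∑ j ∈ range k, (u j - v j) ∈ powIdeal P e := sum_mem fun j hj =>
      sub_mem (hu j (by have := mem_range.1 hj; omega)) (hv j (by have := mem_range.1 hj; omega))
    generalize ∏ j ∈ range k, (1 - u j) / (1 - v j) = A at *
    generalize ∑ j ∈ range k, (u j - v j) = S at *
    generalize u k = a at *
    generalize v k = b at *
    have hab := sub_mem hu1 hv1
    -- Isolates the previous error; the other two terms are products of two elements of order e.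
    have key : A * ((1 - a) / (1 - b)) - (1 - (S + (a - b))) =
        (A - (1 - S)) * ((1 - a) * (1 - b)⁻¹) + S * (a - b) * (1 - b)⁻¹ -
          b * (a - b) * (1 - b)⁻¹ := by
      field_simp; ring
    rw [key]
    have h1 : (1 - a) ∈ localRing P := sub_mem (one_mem _) (powIdeal_le_localRing hu1)
    rw [two_mul] at *
    exact sub_mem (add_mem (mul_mem_powIdeal_right ih (mul_mem h1 i1))
      (mul_mem_powIdeal_right (mul_mem_powIdeal hS hab) i1))
      (mul_mem_powIdeal_right (mul_mem_powIdeal hv1 hab) i1)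

end LocalRing

/-! ### Units and non-units at Φ_n. -/

section Cyclotomic

open Polynomial

/-- The powers of the ideal generated by the `n`-th cyclotomic polynomial. -/
noncomputable abbrev cycIdeal (n e : ℕ) : AddSubgroup (RatFunc ℚ) := powIdeal (cyclotomic n ℚ) e

/-- The local ring at the `n`-th cyclotomic polynomial. -/
noncomputable abbrev cycRing (n : ℕ) : Subring (RatFunc ℚ) := localRing (cyclotomic n ℚ)

variable {n : ℕ}

lemma cyclotomic_not_isUnit (hn : 0 < n) : ¬ IsUnit (cyclotomic n ℚ) :=
  (cyclotomic.irreducible_rat hn).not_isUnit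

lemma q_eq : q = algebraMap ℚ[X] (RatFunc ℚ) X := RatFunc.algebraMap_X.symm

lemma q_ne_zero : q ≠ 0 := RatFunc.X_ne_zero

lemma q_mem : q ∈ cycRing n := by
  rw [q_eq]; exact algebraMap_mem_localRing _

lemma one_sub_q_pow (a : ℕ) : 1 - q ^ a = -algebraMap ℚ[X] (RatFunc ℚ) (X ^ a - 1) := by
  rw [q_eq]; simp

lemma q_inv_mem (hn : 0 < n) : q⁻¹ ∈ cycRing n := by
  rw [q_eq]
  refine inv_algebraMap_mem_localRing ?_ X_ne_zero
  have h : IsCoprime (X ^ n - 1 : ℚ[X]) X := by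
    obtain ⟨k, rfl⟩ := Nat.exists_eq_add_of_lt hn
    exact ⟨-1, X ^ (0 + k), by ring⟩
  exact h.of_isCoprime_of_dvd_left (cyclotomic.dvd_X_pow_sub_one n ℚ)

lemma q_pow_ne_one {a : ℕ} (ha : a ≠ 0) : 1 - q ^ a ≠ 0 := by
  rw [one_sub_q_pow, neg_ne_zero]
  exact RatFunc.algebraMap_ne_zero (monic_X_pow_sub_C (1 : ℚ) ha).ne_zero

/-- X^a - 1 is the product of Φ_i over i dividing a, and Φ_n is prime to each of these when n does
not divide a. -/
lemma inv_one_sub_q_mem {a : ℕ} (h : ¬ n ∣ a) : (1 - q ^ a)⁻¹ ∈ cycRing n := by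
  have ha : 0 < a := Nat.pos_of_ne_zero fun h0 => h (h0 ▸ dvd_zero n)
  rw [one_sub_q_pow, inv_neg]
  refine neg_mem (inv_algebraMap_mem_localRing ?_ ?_)
  · rw [← prod_cyclotomic_eq_X_pow_sub_one ha]
    refine IsCoprime.prod_right fun i hi => cyclotomic.isCoprime_rat ?_
    rintro rfl
    exact h (Nat.dvd_of_mem_divisors hi)
  · simpa using (monic_X_pow_sub_C (1 : ℚ) ha.ne').ne_zero

lemma one_sub_q_mem (a : ℕ) : 1 - q ^ a ∈ cycRing n := sub_mem (one_mem _) (pow_mem q_mem a)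

lemma one_sub_q_self_mem : 1 - q ^ n ∈ cycIdeal n 1 := by
  obtain ⟨c, hc⟩ := cyclotomic.dvd_X_pow_sub_one n ℚ
  rw [one_sub_q_pow, hc]
  exact neg_mem ⟨algebraMap ℚ[X] (RatFunc ℚ) c, algebraMap_mem_localRing c, by simp⟩

lemma two_inv_mem : (2 : RatFunc ℚ)⁻¹ ∈ cycRing n := by
  have : (2 : RatFunc ℚ) = algebraMap ℚ[X] (RatFunc ℚ) (C 2) := by
    rw [← one_add_one_eq_two, ← one_add_one_eq_two, map_add, map_add, map_one, map_one]
  rw [this]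
  refine inv_algebraMap_mem_localRing ?_ (by simp)
  exact ⟨0, C (1 / 2), by rw [zero_mul, zero_add, ← C_mul]; norm_num⟩

end Cyclotomic


/-! ### Deformed factors relative to the undeformed ones. -/

section Factors

variable {K : Type*} [Field K]

/-- The function `x / (1 - x)^2`, invariant under `x ↦ 1/x`. -/
def koebe (x : K) : K := x / (1 - x) ^ 2

lemma poch_mul_poch_div (x p t : K) (ht : t ≠ 0) (k : ℕ) (h : ∀ j < k, 1 - x * p ^ j ≠ 0) :
    poch (x * t) p k * poch (x / t) p k =
      poch x p k ^ 2 * ∏ j ∈ range k, (1 - koebe (x * p ^ j) * ((1 - t) ^ 2 / t)) := by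
  rw [poch, poch, poch, ← prod_pow, ← prod_mul_distrib, ← prod_mul_distrib]
  refine prod_congr rfl fun j hj => ?_
  have := h j (mem_range.1 hj)
  rw [koebe]
  have e1 : x * t * p ^ j = x * p ^ j * t := by ring
  have e2 : x / t * p ^ j = x * p ^ j / t := by ring
  rw [e1, e2]
  generalize x * p ^ j = y at *
  field_simp
  ring

lemma quadProd_eq (x p e : K) (k : ℕ) (h : ∀ j < k, 1 - x * p ^ j ≠ 0) :
    quadProd e x p k = poch x p k ^ 2 * ∏ j ∈ range k, (1 - -(koebe (x * p ^ j) * e)) := by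
  rw [quadProd, poch, ← prod_pow, ← prod_mul_distrib]
  refine prod_congr rfl fun j hj => ?_
  have := h j (mem_range.1 hj)
  rw [koebe, quad]
  generalize x * p ^ j = y at *
  field_simp
  ring

lemma prod_one_sub_sq (u : ℕ → K) (k : ℕ) :
    ∏ j ∈ range k, (1 - u j ^ 2) = (∏ j ∈ range k, (1 - u j)) * ∏ j ∈ range k, (1 - -(u j)) := by
  rw [← prod_mul_distrib]
  exact prod_congr rfl fun j _ => by ring

/-- The pairs (1-xt)(1-x/t) contribute 1 - e·koebe(x) and the quadratics 1 + e·koebe(x), so the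
first-order terms in e cancel. -/
lemma wellPoised_mul_quadProd (a p t : K) (ht : t ≠ 0) (k : ℕ)
    (h : ∀ j < k, 1 - a * p ^ j ≠ 0) (h1 : ∀ j < k, 1 - p * p ^ j ≠ 0) :
    wellPoised a p t k *
        (quadProd ((1 - t) ^ 2 / t) a p k / quadProd ((1 - t) ^ 2 / t) p p k * (p / a) ^ k) =
      poch a p k ^ 6 / poch p p k ^ 6 * (p ^ 2 / a ^ 3) ^ k *
        ∏ j ∈ range k, (1 - (koebe (a * p ^ j) * ((1 - t) ^ 2 / t)) ^ 2) /
          (1 - (koebe (p * p ^ j) * ((1 - t) ^ 2 / t)) ^ 2) := by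
  have e1 := poch_mul_poch_div a p t ht k h
  have e2 := poch_mul_poch_div p p t ht k h1
  have e3 : (p ^ 2 / a ^ 3) ^ k = (p / a ^ 2) ^ k * (p / a) ^ k := by
    rw [← mul_pow]; congr 1; ring
  rw [quadProd_eq _ _ _ k h, quadProd_eq _ _ _ k h1, prod_div_distrib, prod_one_sub_sq,
    prod_one_sub_sq, e3, wellPoised]
  rw [show poch a p k ^ 2 * poch (a * t) p k * poch (a / t) p k =
    poch a p k ^ 2 * (poch (a * t) p k * poch (a / t) p k) by ring, e1]
  rw [show poch p p k ^ 2 * poch (p / t) p k * poch (p * t) p k =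
    poch p p k ^ 2 * (poch (p * t) p k * poch (p / t) p k) by ring, e2]
  generalize ∏ j ∈ range k, (1 - koebe (a * p ^ j) * ((1 - t) ^ 2 / t)) = A
  generalize ∏ j ∈ range k, (1 - -(koebe (a * p ^ j) * ((1 - t) ^ 2 / t))) = B
  generalize ∏ j ∈ range k, (1 - koebe (p * p ^ j) * ((1 - t) ^ 2 / t)) = C
  generalize ∏ j ∈ range k, (1 - -(koebe (p * p ^ j) * ((1 - t) ^ 2 / t))) = D
  simp only [div_eq_mul_inv, mul_inv, mul_pow, inv_pow]
  ring

/-- Here the opposite signs sit in numerator and denominator, so the first-order terms add up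
instead of cancelling; they produce the correction term. -/
lemma saalCoeff_mul_poch (a p t : K) (ht : t ≠ 0) (k : ℕ)
    (h : ∀ j < k, 1 - a * p ^ j ≠ 0) (h1 : ∀ j < k, 1 - p * p ^ j ≠ 0) :
    saalCoeff a p ((1 - t) ^ 2 / t) k *
        (poch (a * t) p k * poch a p k * poch (a / t) p k / poch (a ^ 2) p k) =
      poch a p k ^ 3 * poch (p / a) p k / (poch p p k ^ 3 * poch (a ^ 2) p k) * p ^ k *
        ∏ j ∈ range k, (1 - koebe (a * p ^ j) * ((1 - t) ^ 2 / t)) /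
          (1 - -(koebe (p * p ^ j) * ((1 - t) ^ 2 / t))) := by
  have e1 := poch_mul_poch_div a p t ht k h
  rw [saalCoeff, quadProd_eq _ _ _ k h1, prod_div_distrib]
  rw [show poch (a * t) p k * poch a p k * poch (a / t) p k =
    poch a p k * (poch (a * t) p k * poch (a / t) p k) by ring, e1]
  generalize ∏ j ∈ range k, (1 - koebe (a * p ^ j) * ((1 - t) ^ 2 / t)) = A
  generalize ∏ j ∈ range k, (1 - -(koebe (p * p ^ j) * ((1 - t) ^ 2 / t))) = D
  simp only [div_eq_mul_inv, mul_inv]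
  ring

lemma prod_koebe_div (a p : K) (k : ℕ) :
    ∏ j ∈ range k, koebe (p * p ^ j) / koebe (a * p ^ j) =
      (p / a) ^ k * (poch a p k / poch p p k) ^ 2 := by
  by_cases hp : p = 0
  · subst hp
    cases k with
    | zero => simp [poch]
    | succ k => simp [koebe]
  rw [poch, poch, ← prod_div_distrib, ← prod_pow]
  conv_rhs => rw [← card_range k, ← prod_const, card_range, ← prod_mul_distrib]
  refine prod_congr rfl fun j _ => ?_
  have hpj := pow_ne_zero j hp
  simp only [koebe, div_eq_mul_inv, mul_inv, inv_inv, mul_pow]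
  field_simp

lemma koebe_sub_koebe (x y : K) (hx : 1 - x ≠ 0) (hy : 1 - y ≠ 0) :
    koebe x - koebe y = (1 - x * y) * (x - y) * ((1 - x)⁻¹ ^ 2 * (1 - y)⁻¹ ^ 2) := by
  simp only [koebe]
  field_simp
  ring

end Factors

/-! ### Partial sums and products under k ↦ N - k. -/

section Reflection

variable {P : Polynomial ℚ} {e : ℕ}

/-- Over the full range the values of f are those of g in reverse order, so the total is congruent
to 0. Moving one index from one range to the other preserves the congruence. -/
lemma sum_range_reflection {N : ℕ} (f g : ℕ → RatFunc ℚ)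
    (h : ∀ j l, j + l + 1 = N → f j - g l ∈ powIdeal P e) (k l : ℕ) (hkl : k + l = N) :
    ∑ j ∈ range l, (f j - g j) - ∑ j ∈ range k, (f j - g j) ∈ powIdeal P e := by
  induction k generalizing l with
  | zero =>
    obtain rfl : l = N := by omega
    rw [range_zero, sum_empty, sub_zero, sum_sub_distrib, ← sum_range_reflect, ← sum_sub_distrib]
    exact sum_mem fun j hj => h _ _ (by have := mem_range.1 hj; omega)
  | succ k ih =>
    have := ih (l + 1) (by omega)
    rw [sum_range_succ] at this ⊢
    have h1 := h l k (by omega)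
    have h2 := h k l (by omega)
    convert sub_mem (sub_mem this h1) h2 using 1
    ring

lemma inv_sub_inv_mem {x y : RatFunc ℚ} (hx : x ≠ 0) (hy : y ≠ 0) (hx' : x⁻¹ ∈ localRing P)
    (hy' : y⁻¹ ∈ localRing P) (h : x - y ∈ powIdeal P e) : y⁻¹ - x⁻¹ ∈ powIdeal P e := by
  have : y⁻¹ - x⁻¹ = (x - y) * (x⁻¹ * y⁻¹) := by field_simp
  rw [this]
  exact mul_mem_powIdeal_right h (mul_mem hx' hy')

lemma neg_mem_iff' {x y : RatFunc ℚ} : x - y ∈ powIdeal P e ↔ y - x ∈ powIdeal P e := by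
  rw [← neg_sub, neg_mem_iff]

/-- The multiplicative analogue: the full product is congruent to 1, and f l / g l is congruent to g
k / f k whenever l + k + 1 = N. -/
lemma prod_range_reflection {N : ℕ} (f g : ℕ → RatFunc ℚ)
    (hf : ∀ j < N, f j ≠ 0 ∧ f j ∈ localRing P ∧ (f j)⁻¹ ∈ localRing P)
    (hg : ∀ j < N, g j ≠ 0 ∧ g j ∈ localRing P ∧ (g j)⁻¹ ∈ localRing P)
    (h : ∀ j l, j + l + 1 = N → f j - g l ∈ powIdeal P e) (k l : ℕ) (hkl : k + l = N) :
    ∏ j ∈ range l, g j / f j - ∏ j ∈ range k, g j / f j ∈ powIdeal P e := by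
  have mem : ∀ l ≤ N, ∏ j ∈ range l, g j / f j ∈ localRing P := fun l hl =>
    prod_mem fun j hj => by
      have := mem_range.1 hj
      rw [div_eq_mul_inv]
      exact mul_mem (hg j (by omega)).2.1 (hf j (by omega)).2.2
  induction k generalizing l with
  | zero =>
    obtain rfl : l = N := by omega
    have h1 : ∏ j ∈ range l, g j - ∏ j ∈ range l, f j ∈ powIdeal P e := by
      rw [← prod_range_reflect f]
      refine prod_sub_prod_mem _ _ _ (fun j hj => (hg j (mem_range.1 hj)).2.1)
        (fun j hj => (hf _ (by have := mem_range.1 hj; omega)).2.1) fun j hj => ?_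
      have := mem_range.1 hj
      exact neg_mem_iff'.1 (h _ _ (by omega))
    have h2 : ∏ j ∈ range l, f j ≠ 0 := prod_ne_zero_iff.2 fun j hj => (hf j (mem_range.1 hj)).1
    have h3 : (∏ j ∈ range l, f j)⁻¹ ∈ localRing P := by
      rw [← prod_inv_distrib]
      exact prod_mem fun j hj => (hf j (mem_range.1 hj)).2.2
    rw [range_zero, prod_empty, prod_div_distrib]
    have : (∏ j ∈ range l, g j) / (∏ j ∈ range l, f j) - 1 =
        (∏ j ∈ range l, g j - ∏ j ∈ range l, f j) * (∏ j ∈ range l, f j)⁻¹ := by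
      field_simp
    rw [this]
    exact mul_mem_powIdeal_right h1 h3
  | succ k ih =>
    have ih := ih (l + 1) (by omega)
    have fl := hf l (by omega)
    have gl := hg l (by omega)
    have fk := hf k (by omega)
    have gk := hg k (by omega)
    have e1 : ∏ j ∈ range l, g j / f j = (∏ j ∈ range (l + 1), g j / f j) * (f l * (g l)⁻¹) := by
      rw [prod_range_succ]
      have := fl.1
      have := gl.1
      field_simp
    rw [e1, prod_range_succ _ k, div_eq_mul_inv (g k)]
    refine mul_sub_mul_mem ih ?_ (mem _ (by omega)) (mul_mem gk.2.1 fk.2.2)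
    refine mul_sub_mul_mem (h l k (by omega)) ?_ fl.2.1 fk.2.2
    exact inv_sub_inv_mem fk.1 gl.1 fk.2.2 gl.2.2 (h k l (by omega))

end Reflection

/-! ### The summands modulo powers of Φ_n. -/

section Theta

/-- The standing conditions on the parameters, with `N = (n - r) / d`. -/
structure Admissible (d n r N : ℕ) : Prop where
  one_lt_n : 1 < n
  r_pos : 0 < r
  one_lt_d : 1 < d
  eq : r + d * N = n
  coprime : Nat.Coprime n d

variable {d n r N : ℕ}

namespace Admissible

lemma n_pos (H : Admissible d n r N) : 0 < n := H.one_lt_n.le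

lemma lt_n (H : Admissible d n r N) : N < n := by
  have := H.eq
  have := H.r_pos
  have := H.one_lt_d
  nlinarith

lemma not_dvd_r (H : Admissible d n r N) {j : ℕ} (hj : j < N) : ¬ n ∣ r + d * j := by
  intro h
  have h1 := Nat.le_of_dvd (by have := H.r_pos; omega) h
  rw [← H.eq] at h1
  have h2 := Nat.mul_lt_mul_of_pos_left hj (by have := H.one_lt_d; omega : 0 < d)
  omega

lemma not_dvd_d (H : Admissible d n r N) {j : ℕ} (hj : j + 1 < n) : ¬ n ∣ d + d * j := by
  intro h
  have h1 : n ∣ d * (j + 1) := by rwa [mul_add, mul_one, add_comm]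
  have h2 := Nat.le_of_dvd (by omega) (H.coprime.dvd_of_dvd_mul_left h1)
  omega

/-- The number lies strictly between 0 and 2n, so it could only equal n; then d would divide r,
hence n, against coprimality. -/
lemma not_dvd_two_r (H : Admissible d n r N) {j : ℕ} (hj : j < N) : ¬ n ∣ 2 * r + d * j := by
  rintro ⟨c, hc⟩
  have h2 := Nat.mul_lt_mul_of_pos_left hj (by have := H.one_lt_d; omega : 0 < d)
  have h3 := H.eq
  have h4 := H.r_pos
  have hc1 : c < 2 := by
    by_contra h
    have : n * 2 ≤ n * c := Nat.mul_le_mul_left n (by omega)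
    omega
  obtain rfl : c = 1 := by
    rcases Nat.eq_zero_or_pos c with rfl | h
    · omega
    · omega
  have h5 : r = d * (N - j) := by
    rw [Nat.mul_sub]; omega
  have h6 : d ∣ n := by
    rw [← H.eq]; exact dvd_add (h5 ▸ dvd_mul_right _ _) (dvd_mul_right _ _)
  have := Nat.dvd_gcd h6 dvd_rfl
  rw [H.coprime] at this
  have := Nat.le_of_dvd one_pos this
  have := H.one_lt_d
  omega

end Admissible

lemma koebe_mem {a : ℕ} (h : ¬ n ∣ a) : koebe (q ^ a) ∈ cycRing n := by
  rw [koebe, div_eq_mul_inv, ← inv_pow]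
  exact mul_mem (pow_mem q_mem a) (pow_mem (inv_one_sub_q_mem h) 2)

lemma koebe_inv_mem (hn : 0 < n) (a : ℕ) : (koebe (q ^ a))⁻¹ ∈ cycRing n := by
  rw [koebe, inv_div, div_eq_mul_inv, ← inv_pow]
  exact mul_mem (pow_mem (one_sub_q_mem a) 2) (pow_mem (q_inv_mem hn) a)

lemma koebe_ne_zero {a : ℕ} (h : a ≠ 0) : koebe (q ^ a) ≠ 0 :=
  div_ne_zero (pow_ne_zero _ q_ne_zero) (pow_ne_zero _ (q_pow_ne_one h))

lemma koebe_reflect {a b : ℕ} (hab : a + b = n) (ha : ¬ n ∣ a) (hb : ¬ n ∣ b) :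
    koebe (q ^ a) - koebe (q ^ b) ∈ cycIdeal n 1 := by
  have ha0 : a ≠ 0 := fun h0 => ha (h0 ▸ dvd_zero n)
  have hb0 : b ≠ 0 := fun h0 => hb (h0 ▸ dvd_zero n)
  rw [koebe_sub_koebe _ _ (q_pow_ne_one ha0) (q_pow_ne_one hb0), ← pow_add, hab]
  refine mul_mem_powIdeal_right (mul_mem_powIdeal_right one_sub_q_self_mem ?_) ?_
  · exact sub_mem (pow_mem q_mem a) (pow_mem q_mem b)
  · exact mul_mem (pow_mem (inv_one_sub_q_mem ha) 2) (pow_mem (inv_one_sub_q_mem hb) 2)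

lemma qPoch_eq (x p : RatFunc ℚ) (k : ℕ) : qPoch x p k = poch x p k := rfl

lemma qInt_natCast (a : ℕ) : qInt a = (1 - q ^ a) / (1 - q) := by rw [qInt, zpow_natCast]

lemma theta_eq_base (k : ℕ) : theta d r k = (1 - q ^ r * ((q ^ d) ^ k) ^ 2) / (1 - q) *
    (poch (q ^ r) (q ^ d) k ^ 6 / poch (q ^ d) (q ^ d) k ^ 6 *
      ((q ^ d) ^ 2 / (q ^ r) ^ 3) ^ k) := by
  have e1 : q ^ ((2 * (d : ℤ) - 3 * (r : ℤ)) * (k : ℤ)) = ((q ^ d) ^ 2 / (q ^ r) ^ 3) ^ k := by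
    rw [zpow_mul, zpow_natCast, zpow_sub₀ q_ne_zero]
    congr 2
    · rw [← pow_mul, mul_comm, ← zpow_natCast]; congr 1
    · rw [← pow_mul, mul_comm, ← zpow_natCast]; congr 1
  have e2 : qInt (2 * d * k + r) = (1 - q ^ r * ((q ^ d) ^ k) ^ 2) / (1 - q) := by
    have : (2 * d * k + r : ℤ) = ((2 * d * k + r : ℕ) : ℤ) := by push_cast; ring
    rw [this, qInt_natCast]; congr 2; ring
  rw [theta, e1, e2, qPoch_eq, qPoch_eq]; ring

/-- This form exposes the symmetry: the product is even under k ↦ N - k modulo Φ_n, and the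
prefactor is odd. -/
lemma theta_eq_symm (k : ℕ) : theta d r k =
    (1 - q ^ r * ((q ^ d) ^ k) ^ 2) / (q ^ d) ^ k * (1 - q)⁻¹ *
      (∏ j ∈ range k, koebe (q ^ d * (q ^ d) ^ j) / koebe (q ^ r * (q ^ d) ^ j)) ^ 3 := by
  have hd := pow_ne_zero d q_ne_zero
  have hr := pow_ne_zero r q_ne_zero
  rw [theta_eq_base, prod_koebe_div]
  generalize poch (q ^ r) (q ^ d) k = A
  generalize poch (q ^ d) (q ^ d) k = B
  generalize q ^ d = p at *
  generalize q ^ r = a at *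
  have e : (p ^ 2 / a ^ 3) ^ k * p ^ k = ((p / a) ^ k) ^ 3 := by
    rw [← mul_pow, ← pow_mul, mul_comm k 3, pow_mul]; congr 1; field_simp
  have hpk := pow_ne_zero k hd
  rw [mul_pow, ← e]
  generalize (p ^ 2 / a ^ 3) ^ k = C
  simp only [div_eq_mul_inv]
  field_simp

lemma q_mul_pow (a d j : ℕ) : q ^ a * (q ^ d) ^ j = q ^ (a + d * j) := by
  rw [← pow_mul, ← pow_add]

/-- The exponents r + dj and d + dl add up to n, and `koebe` is invariant under x ↦ 1/x. -/
lemma Admissible.reflect (H : Admissible d n r N) (j l : ℕ) (h : j + l + 1 = N) :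
    koebe (q ^ r * (q ^ d) ^ j) - koebe (q ^ d * (q ^ d) ^ l) ∈ cycIdeal n 1 := by
  rw [q_mul_pow, q_mul_pow]
  have := H.lt_n
  refine koebe_reflect ?_ (H.not_dvd_r (by omega)) (H.not_dvd_d (by omega))
  rw [← H.eq, ← h]; ring

lemma theta_reflect (H : Admissible d n r N) (k l : ℕ) (hkl : k + l = N) :
    theta d r k + theta d r l ∈ cycIdeal n 1 := by
  have hlt := H.lt_n
  have h1 := prod_range_reflection (P := Polynomial.cyclotomic n ℚ) (e := 1) (N := N)
    (fun j => koebe (q ^ r * (q ^ d) ^ j)) (fun j => koebe (q ^ d * (q ^ d) ^ j))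
    (fun j hj => by
      have := H.r_pos
      rw [q_mul_pow]
      exact ⟨koebe_ne_zero (by omega), koebe_mem (H.not_dvd_r hj), koebe_inv_mem H.n_pos _⟩)
    (fun j hj => by
      have := H.one_lt_d
      rw [q_mul_pow]
      exact ⟨koebe_ne_zero (by omega), koebe_mem (H.not_dvd_d (by omega)),
        koebe_inv_mem H.n_pos _⟩) H.reflect
  have mem : ∀ k ≤ N, ∏ j ∈ range k, koebe (q ^ d * (q ^ d) ^ j) / koebe (q ^ r * (q ^ d) ^ j) ∈
      cycRing n := fun k hk => prod_mem fun j hj => by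
    have := mem_range.1 hj
    rw [div_eq_mul_inv, q_mul_pow, q_mul_pow]
    exact mul_mem (koebe_mem (H.not_dvd_d (by omega))) (koebe_inv_mem H.n_pos _)
  have h3 := pow_sub_pow_mem (h1 k l hkl) (mem l (by omega)) (mem k (by omega)) 3
  have m3 := pow_mem (mem l (by omega)) 3
  rw [theta_eq_symm, theta_eq_symm]
  generalize (∏ j ∈ range k, koebe (q ^ d * (q ^ d) ^ j) / koebe (q ^ r * (q ^ d) ^ j)) ^ 3 = A at *
  generalize (∏ j ∈ range l, koebe (q ^ d * (q ^ d) ^ j) / koebe (q ^ r * (q ^ d) ^ j)) ^ 3 = B at *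
  have hi : (1 - q)⁻¹ ∈ cycRing n := by
    simpa using inv_one_sub_q_mem (n := n) (a := 1) (by have := H.one_lt_n; simp; omega)
  have hd := pow_ne_zero d q_ne_zero
  have i1 : ∀ k, (1 - q ^ r * ((q ^ d) ^ k) ^ 2) / (q ^ d) ^ k ∈ cycRing n := fun k => by
    rw [div_eq_mul_inv, ← inv_pow, ← inv_pow]
    exact mul_mem (sub_mem (one_mem _) (mul_mem (pow_mem q_mem _)
      (pow_mem (pow_mem (pow_mem q_mem _) _) _))) (pow_mem (pow_mem (q_inv_mem H.n_pos) _) _)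
  have i2 : (1 - q ^ r * ((q ^ d) ^ k) ^ 2) / (q ^ d) ^ k +
      (1 - q ^ r * ((q ^ d) ^ l) ^ 2) / (q ^ d) ^ l ∈ cycIdeal n 1 := by
    have e : (1 - q ^ r * ((q ^ d) ^ k) ^ 2) / (q ^ d) ^ k +
      (1 - q ^ r * ((q ^ d) ^ l) ^ 2) / (q ^ d) ^ l = (1 - q ^ n) *
        (((q ^ d) ^ k + (q ^ d) ^ l) * ((q ^ d) ^ k)⁻¹ * ((q ^ d) ^ l)⁻¹) := by
      have hn : q ^ n = q ^ r * (q ^ d) ^ k * (q ^ d) ^ l := by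
        rw [q_mul_pow, ← pow_mul, ← pow_add, ← H.eq, ← hkl]; congr 1; ring
      rw [hn]
      have := pow_ne_zero k hd
      have := pow_ne_zero l hd
      field_simp
      ring
    rw [e]
    simp only [← inv_pow]
    refine mul_mem_powIdeal_right one_sub_q_self_mem (mul_mem (mul_mem (add_mem ?_ ?_) ?_) ?_)
    · exact pow_mem (pow_mem q_mem _) _
    · exact pow_mem (pow_mem q_mem _) _
    · exact pow_mem (pow_mem (q_inv_mem H.n_pos) _) _
    · exact pow_mem (pow_mem (q_inv_mem H.n_pos) _) _
  have j1 := i1 k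
  generalize (1 - q ^ r * ((q ^ d) ^ k) ^ 2) / (q ^ d) ^ k = X at *
  generalize (1 - q ^ r * ((q ^ d) ^ l) ^ 2) / (q ^ d) ^ l = Y at *
  have : X * (1 - q)⁻¹ * A + Y * (1 - q)⁻¹ * B =
    (X + Y) * ((1 - q)⁻¹ * B) - (X * (1 - q)⁻¹) * (B - A) := by ring
  rw [this]
  exact sub_mem (mul_mem_powIdeal_right i2 (mul_mem hi m3))
    (mul_mem_powIdeal_left (mul_mem j1 hi) h3)

lemma poch_inv_mem {x p : RatFunc ℚ} {k : ℕ} (h : ∀ j < k, (1 - x * p ^ j)⁻¹ ∈ cycRing n) :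
    (poch x p k)⁻¹ ∈ cycRing n := by
  rw [poch, ← prod_inv_distrib]
  exact prod_mem fun j hj => h j (mem_range.1 hj)

lemma poch_mem {x p : RatFunc ℚ} (hx : x ∈ cycRing n) (hp : p ∈ cycRing n) (k : ℕ) :
    poch x p k ∈ cycRing n :=
  prod_mem fun j _ => sub_mem (one_mem _) (mul_mem hx (pow_mem hp j))

lemma Admissible.poch_inv_mem (H : Admissible d n r N) {k : ℕ} (hk : k < n) :
    (poch (q ^ d) (q ^ d) k)⁻¹ ∈ cycRing n := by
  refine QSuper.poch_inv_mem fun j hj => ?_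
  rw [q_mul_pow]
  exact inv_one_sub_q_mem (H.not_dvd_d (by omega))

lemma inv_one_sub_q_one_mem (hn : 1 < n) : (1 - q)⁻¹ ∈ cycRing n := by
  simpa using inv_one_sub_q_mem (n := n) (a := 1) (by simp; omega)

lemma theta_cofactor_mem (H : Admissible d n r N) {k : ℕ} (hk : k < n) :
    (1 - q ^ r * ((q ^ d) ^ k) ^ 2) * (1 - q)⁻¹ * (poch (q ^ d) (q ^ d) k)⁻¹ ^ 6 *
      ((q ^ d) ^ 2 * q⁻¹ ^ (r * 3)) ^ k ∈ cycRing n := by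
  refine mul_mem (mul_mem (mul_mem (sub_mem (one_mem _) ?_) (inv_one_sub_q_one_mem H.one_lt_n))
    (pow_mem (H.poch_inv_mem hk) 6)) (pow_mem (mul_mem ?_ ?_) _)
  · exact mul_mem (pow_mem q_mem _) (pow_mem (pow_mem (pow_mem q_mem _) _) _)
  · exact pow_mem (pow_mem q_mem _) _
  · exact pow_mem (q_inv_mem H.n_pos) _

lemma theta_eq_mul_cofactor (k : ℕ) : theta d r k = poch (q ^ r) (q ^ d) k ^ 6 *
    ((1 - q ^ r * ((q ^ d) ^ k) ^ 2) * (1 - q)⁻¹ * (poch (q ^ d) (q ^ d) k)⁻¹ ^ 6 *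
      ((q ^ d) ^ 2 * q⁻¹ ^ (r * 3)) ^ k) := by
  rw [theta_eq_base, inv_pow q (r * 3), pow_mul q r 3]
  simp only [div_eq_mul_inv, inv_pow]
  ring

lemma theta_mem (H : Admissible d n r N) {k : ℕ} (hk : k < n) : theta d r k ∈ cycRing n := by
  rw [theta_eq_mul_cofactor]
  exact mul_mem (pow_mem (poch_mem (pow_mem q_mem _) (pow_mem q_mem _) _) _)
    (theta_cofactor_mem H hk)

/-- The factor with index N in (q^r; q^d)_k is 1 - q^n, and it occurs to the sixth power. -/
lemma theta_mem_six (H : Admissible d n r N) {k : ℕ} (hk : k < n) (hN : N < k) :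
    theta d r k ∈ cycIdeal n 6 := by
  rw [theta_eq_mul_cofactor]
  refine mul_mem_powIdeal_right ?_ (theta_cofactor_mem H hk)
  refine pow_mem_powIdeal (e := 1) ?_ 6
  rw [poch, ← mul_prod_erase _ _ (mem_range.2 hN)]
  refine mul_mem_powIdeal_right ?_ (prod_mem fun j _ => sub_mem (one_mem _)
    (mul_mem (pow_mem q_mem _) (pow_mem (pow_mem q_mem _) _)))
  rw [q_mul_pow, H.eq]
  exact one_sub_q_self_mem

/-- The sum is the coefficient of -e^2 in the deformed sum. An odd function times an even one,
summed over a symmetric range, equals its own negative modulo Φ_n, and 2 is invertible. -/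
lemma sum_theta_mul_mem (H : Admissible d n r N) :
    ∑ k ∈ range (N + 1), theta d r k * ∑ j ∈ range k, (koebe (q ^ r * (q ^ d) ^ j) ^ 2 -
      koebe (q ^ d * (q ^ d) ^ j) ^ 2) ∈ cycIdeal n 1 := by
  have hlt := H.lt_n
  have h1 : ∀ j < N, koebe (q ^ r * (q ^ d) ^ j) ∈ cycRing n := fun j hj => by
    rw [q_mul_pow]; exact koebe_mem (H.not_dvd_r hj)
  have h2 : ∀ j < N, koebe (q ^ d * (q ^ d) ^ j) ∈ cycRing n := fun j hj => by
    rw [q_mul_pow]; exact koebe_mem (H.not_dvd_d (by omega))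
  have hS := sum_range_reflection (P := Polynomial.cyclotomic n ℚ) (e := 1) (N := N)
    (fun j => koebe (q ^ r * (q ^ d) ^ j) ^ 2) (fun j => koebe (q ^ d * (q ^ d) ^ j) ^ 2)
    (fun j l h => pow_sub_pow_mem (H.reflect j l h) (h1 j (by omega)) (h2 l (by omega)) 2)
  have mS : ∀ k ≤ N, ∑ j ∈ range k, (koebe (q ^ r * (q ^ d) ^ j) ^ 2 -
      koebe (q ^ d * (q ^ d) ^ j) ^ 2) ∈ cycRing n := fun k hk => sum_mem fun j hj => by
    have := mem_range.1 hj
    exact sub_mem (pow_mem (h1 j (by omega)) 2) (pow_mem (h2 j (by omega)) 2)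
  generalize hσ : (fun k => ∑ j ∈ range k, (koebe (q ^ r * (q ^ d) ^ j) ^ 2 -
      koebe (q ^ d * (q ^ d) ^ j) ^ 2)) = σ
  have hσ' : ∀ k, ∑ j ∈ range k, (koebe (q ^ r * (q ^ d) ^ j) ^ 2 -
      koebe (q ^ d * (q ^ d) ^ j) ^ 2) = σ k := fun k => by rw [← hσ]
  simp only [hσ'] at *
  have key : ∑ k ∈ range (N + 1), (theta d r k * σ k + theta d r (N - k) * σ (N - k)) ∈
      cycIdeal n 1 := sum_mem fun k hk => by
    have hk := mem_range.1 hk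
    have a1 := theta_reflect H k (N - k) (by omega)
    have a2 := hS k (N - k) (by omega)
    have : theta d r k * σ k + theta d r (N - k) * σ (N - k) =
      (theta d r k + theta d r (N - k)) * σ k + theta d r (N - k) * (σ (N - k) - σ k) := by ring
    rw [this]
    exact add_mem (mul_mem_powIdeal_right a1 (mS k (by omega)))
      (mul_mem_powIdeal_left (theta_mem H (by omega)) a2)
  have e := sum_range_reflect (fun k => theta d r k * σ k) (N + 1)
  simp only [Nat.add_sub_cancel] at e
  rw [sum_add_distrib, e, ← two_mul] at key
  have := mul_mem_powIdeal_left two_inv_mem key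
  rwa [inv_mul_cancel_left₀ two_ne_zero] at this

lemma term_eq (k : ℕ) : term d r k =
    poch (q ^ r) (q ^ d) k ^ 3 * poch (q ^ d / q ^ r) (q ^ d) k /
      (poch (q ^ d) (q ^ d) k ^ 3 * poch ((q ^ r) ^ 2) (q ^ d) k) * (q ^ d) ^ k := by
  rw [term, zpow_sub₀ q_ne_zero, zpow_natCast, zpow_natCast, ← pow_mul q d k, ← pow_mul q r 2,
    mul_comm r 2]
  rfl

lemma term_mem (H : Admissible d n r N) {k : ℕ} (hk : k ≤ N) : term d r k ∈ cycRing n := by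
  have hlt := H.lt_n
  rw [term_eq, div_eq_mul_inv, div_eq_mul_inv, mul_inv, ← inv_pow, ← inv_pow]
  refine mul_mem (mul_mem (mul_mem (pow_mem (poch_mem ?_ ?_ _) _) (poch_mem ?_ ?_ _))
    (mul_mem (pow_mem (H.poch_inv_mem (by omega)) _) (poch_inv_mem fun j hj => ?_))) ?_
  · exact pow_mem q_mem _
  · exact pow_mem q_mem _
  · exact mul_mem (pow_mem q_mem _) (pow_mem (q_inv_mem H.n_pos) _)
  · exact pow_mem q_mem _
  · rw [← pow_mul, q_mul_pow, mul_comm r 2]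
    exact inv_one_sub_q_mem (H.not_dvd_two_r (by omega))
  · exact pow_mem (pow_mem q_mem _) _

lemma eps_mem (hn : 0 < n) : (1 - q ^ n) ^ 2 / q ^ n ∈ cycIdeal n 2 := by
  rw [div_eq_mul_inv, ← inv_pow]
  exact mul_mem_powIdeal_right (pow_mem_powIdeal one_sub_q_self_mem 2)
    (pow_mem (q_inv_mem hn) n)

lemma koebe_r_mem (H : Admissible d n r N) {j : ℕ} (hj : j < N) :
    koebe (q ^ r * (q ^ d) ^ j) ∈ cycRing n := by
  rw [q_mul_pow]; exact koebe_mem (H.not_dvd_r hj)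

lemma koebe_d_mem (H : Admissible d n r N) {j : ℕ} (hj : j < N) :
    koebe (q ^ d * (q ^ d) ^ j) ∈ cycRing n := by
  have := H.lt_n
  rw [q_mul_pow]; exact koebe_mem (H.not_dvd_d (by omega))

/-- `q_watson` at a = q^r, p = q^d, t = q^n, e = (1-t)^2/t; the factor 1 - t, divided by 1 - q,
becomes [n]. -/
lemma theta_watson (H : Admissible d n r N) :
    ∑ k ∈ range (N + 1), theta d r k *
      ∏ j ∈ range k, (1 - (koebe (q ^ r * (q ^ d) ^ j) * ((1 - q ^ n) ^ 2 / q ^ n)) ^ 2) /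
        (1 - (koebe (q ^ d * (q ^ d) ^ j) * ((1 - q ^ n) ^ 2 / q ^ n)) ^ 2) =
    qInt n * (poch ((q ^ r) ^ 2) (q ^ d) N / poch (q ^ d) (q ^ d) N / (q ^ r) ^ N) *
      ∑ k ∈ range (N + 1), term d r k *
        ∏ j ∈ range k, (1 - koebe (q ^ r * (q ^ d) ^ j) * ((1 - q ^ n) ^ 2 / q ^ n)) /
          (1 - -(koebe (q ^ d * (q ^ d) ^ j) * ((1 - q ^ n) ^ 2 / q ^ n))) := by
  have hr0 := H.r_pos
  have hd0 := H.one_lt_d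
  have hN : q ^ r * (q ^ d) ^ N = q ^ n := by rw [q_mul_pow, H.eq]
  have hq := q_ne_zero
  have hq1 : 1 - q ≠ 0 := by simpa using q_pow_ne_one one_ne_zero
  have ne : ∀ a b k : ℕ, a ≠ 0 → 1 - q ^ a * (q ^ d) ^ k ≠ 0 := fun a b k h => by
    rw [q_mul_pow]; exact q_pow_ne_one (by omega)
  have hle : ∀ k < N, d + d * k ≤ d * N := fun k hk => by
    have := Nat.mul_le_mul_left d (Nat.succ_le_of_lt hk)
    rwa [Nat.succ_eq_add_one, mul_add, mul_one, add_comm] at this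
  have inv_ne : ∀ a k : ℕ, a + d * k < n → 1 - q ^ a / q ^ n * (q ^ d) ^ k ≠ 0 := by
    intro a k h h0
    have h1 : q ^ n - q ^ (a + d * k) = 0 := by
      rw [← q_mul_pow]
      field_simp at h0
      linear_combination h0
    obtain ⟨c, hc⟩ := Nat.exists_eq_add_of_lt h
    have h2 : q ^ (a + d * k) * (1 - q ^ (c + 1)) = 0 := by
      rw [hc] at h1
      linear_combination -h1
    exact mul_ne_zero (pow_ne_zero _ hq) (q_pow_ne_one (Nat.succ_ne_zero c)) h2
  have W := q_watson (q ^ r) (q ^ d) (q ^ n) ((1 - q ^ n) ^ 2 / q ^ n) (pow_ne_zero _ hq)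
    (pow_ne_zero _ hq) (pow_ne_zero _ hq) N hN (fun k _ => ne r 0 k (by omega))
    (fun k _ => ne d 0 k (by omega))
    (fun k hk => inv_ne d k (by have := hle k hk; have := H.eq; omega))
    (fun k _ => by rw [← pow_add]; exact ne _ 0 k (by omega))
    (fun k _ => by rw [← pow_add]; exact ne _ 0 k (by omega))
    (fun k hk => inv_ne r k (by have := hle k hk; have := H.eq; omega))
    (fun k _ => by rw [← pow_mul]; exact ne _ 0 k (by omega))
    (fun k hk => by
      have h1 : 1 - q ^ d * (q ^ d) ^ k ≠ 0 := ne d 0 k (by omega)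
      -- The quadratic is nonzero because it is (1-x)^2 times an element congruent to 1 modulo
      -- Φ_n^2.
      have h2 := (inv_one_sub_mem (cyclotomic_not_isUnit H.n_pos) (powIdeal_mono one_le_two
        (neg_mem (mul_mem_powIdeal_left (koebe_d_mem H hk) (eps_mem H.n_pos))))).2
      have : quad ((1 - q ^ n) ^ 2 / q ^ n) (q ^ d * (q ^ d) ^ k) = (1 - q ^ d * (q ^ d) ^ k) ^ 2 *
          (1 - -(koebe (q ^ d * (q ^ d) ^ k) * ((1 - q ^ n) ^ 2 / q ^ n))) := by
        rw [quad, koebe]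
        generalize q ^ d * (q ^ d) ^ k = x at *
        field_simp
        ring
      rw [this]
      exact mul_ne_zero (pow_ne_zero _ h1) h2)
  have L : ∀ k ∈ range (N + 1), wellPoised (q ^ r) (q ^ d) (q ^ n) k *
      (1 - q ^ r * ((q ^ d) ^ k) ^ 2) * (quadProd ((1 - q ^ n) ^ 2 / q ^ n) (q ^ r) (q ^ d) k /
        quadProd ((1 - q ^ n) ^ 2 / q ^ n) (q ^ d) (q ^ d) k * (q ^ d / q ^ r) ^ k) = (1 - q) *
      (theta d r k *
      ∏ j ∈ range k, (1 - (koebe (q ^ r * (q ^ d) ^ j) * ((1 - q ^ n) ^ 2 / q ^ n)) ^ 2) /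
        (1 - (koebe (q ^ d * (q ^ d) ^ j) * ((1 - q ^ n) ^ 2 / q ^ n)) ^ 2)) := fun k _ => by
    have := wellPoised_mul_quadProd (q ^ r) (q ^ d) (q ^ n) (pow_ne_zero _ hq) k
      (fun j _ => ne r 0 j (by omega)) (fun j _ => ne d 0 j (by omega))
    rw [mul_right_comm, this, theta_eq_base]
    generalize ∏ j ∈ range k, (1 - (koebe (q ^ r * (q ^ d) ^ j) * ((1 - q ^ n) ^ 2 / q ^ n)) ^ 2) /
        (1 - (koebe (q ^ d * (q ^ d) ^ j) * ((1 - q ^ n) ^ 2 / q ^ n)) ^ 2) = A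
    generalize poch (q ^ r) (q ^ d) k ^ 6 / poch (q ^ d) (q ^ d) k ^ 6 *
      ((q ^ d) ^ 2 / (q ^ r) ^ 3) ^ k = B
    field_simp
  rw [sum_congr rfl L, ← mul_sum] at W
  have R : ∀ k ∈ range (N + 1), _ = _ := fun k _ =>
    saalCoeff_mul_poch (q ^ r) (q ^ d) (q ^ n) (pow_ne_zero _ hq) k
      (fun j _ => ne r 0 j (by omega)) (fun j _ => ne d 0 j (by omega))
  rw [sum_congr rfl R] at W
  rw [← mul_right_inj' hq1, W, qInt_natCast]
  simp only [term_eq]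
  field_simp

end Theta


/-! ### From the single sum to the multiple sum. -/

section Conclusion

variable {d m n r N : ℕ}

lemma multiSum_sub_mem (H : Admissible d n r N) (hmd : m ≤ d) :
    multiSum d m n r - (∑ k ∈ range (N + 1), theta d r k) ^ m ∈ cycIdeal n 6 := by
  have hlt := H.lt_n
  have e1 : (∑ k ∈ range (N + 1), theta d r k) ^ m =
      ∑ i ∈ Fintype.piFinset fun _ : Fin m => range (N + 1), ∏ j, theta d r (i j) := by
    rw [← prod_univ_sum]; simp
  have hsub : (Fintype.piFinset fun _ : Fin m => range (N + 1)) ⊆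
      {i ∈ Fintype.piFinset fun _ : Fin m => range n | ∑ j, i j ≤ n - 1} := by
    intro i hi
    rw [Fintype.mem_piFinset] at hi
    simp only [mem_filter, Fintype.mem_piFinset, mem_range] at hi ⊢
    refine ⟨fun j => by have := hi j; omega, ?_⟩
    -- The total is at most mN ≤ dN = n - r ≤ n - 1.
    have h1 : ∑ j, i j ≤ m * N := by
      simpa using sum_le_card_nsmul univ i N fun j _ => by have := hi j; omega
    have h2 := Nat.mul_le_mul_right N hmd
    have := H.eq
    have := H.r_pos
    omega
  rw [e1, multiSum, ← sum_sdiff hsub, add_sub_cancel_right]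
  refine sum_mem fun i hi => ?_
  simp only [mem_sdiff, mem_filter, Fintype.mem_piFinset, mem_range, not_forall, not_lt] at hi
  obtain ⟨⟨h1, -⟩, j, hj⟩ := hi
  rw [← mul_prod_erase _ _ (mem_univ j)]
  exact mul_mem_powIdeal_right (theta_mem_six H (h1 j) hj)
    (prod_mem fun l _ => theta_mem H (h1 l))

lemma qInt_self_mem (hn : 1 < n) : qInt n ∈ cycIdeal n 1 := by
  rw [qInt_natCast, div_eq_mul_inv]
  exact mul_mem_powIdeal_right one_sub_q_self_mem (inv_one_sub_q_one_mem hn)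

lemma prefactor_mem (H : Admissible d n r N) :
    poch ((q ^ r) ^ 2) (q ^ d) N / poch (q ^ d) (q ^ d) N / (q ^ r) ^ N ∈ cycRing n := by
  rw [div_eq_mul_inv, div_eq_mul_inv, ← inv_pow, ← inv_pow]
  exact mul_mem (mul_mem (poch_mem (pow_mem (pow_mem q_mem _) _) (pow_mem q_mem _) _)
    (H.poch_inv_mem H.lt_n)) (pow_mem (pow_mem (q_inv_mem H.n_pos) _) _)

lemma sum_term_mem (H : Admissible d n r N) : ∑ k ∈ range (N + 1), term d r k ∈ cycRing n :=
  sum_mem fun k hk => term_mem H (by have := mem_range.1 hk; omega)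

/-- Since 1/t - (2 - t) = (1-t)^2/t, the polynomial factor 2 - q^n may replace q^(-n) at this
precision. -/
lemma eps_sub_mem (hn : 0 < n) :
    (1 - q ^ n) ^ 2 / q ^ n - (2 - q ^ n) * (1 - q ^ n) ^ 2 ∈ cycIdeal n 4 := by
  have : (1 - q ^ n) ^ 2 / q ^ n - (2 - q ^ n) * (1 - q ^ n) ^ 2 =
      (1 - q ^ n) ^ 4 * q⁻¹ ^ n := by
    have := pow_ne_zero n q_ne_zero
    rw [inv_pow]; field_simp; ring
  rw [this]
  exact mul_mem_powIdeal_right (pow_mem_powIdeal one_sub_q_self_mem 4) (pow_mem (q_inv_mem hn) n)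

lemma delta_mem (n : ℕ) : (2 - q ^ n) * (1 - q ^ n) ^ 2 ∈ cycIdeal n 2 := by
  refine mul_mem_powIdeal_left ?_ (pow_mem_powIdeal one_sub_q_self_mem 2)
  rw [show (2 : RatFunc ℚ) - q ^ n = 1 + (1 - q ^ n) by ring]
  exact add_mem (one_mem _) (one_sub_q_mem n)

lemma sum_koebe_mem (H : Admissible d n r N) {k : ℕ} (hk : k ≤ N) :
    ∑ j ∈ range k, (koebe (q ^ r * (q ^ d) ^ j) + koebe (q ^ d * (q ^ d) ^ j)) ∈ cycRing n :=
  sum_mem fun j hj => by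
    have := mem_range.1 hj
    exact add_mem (koebe_r_mem H (by omega)) (koebe_d_mem H (by omega))

lemma sum_theta_sub_mem (H : Admissible d n r N) :
    ∑ k ∈ range (N + 1), theta d r k -
      qInt n * (poch ((q ^ r) ^ 2) (q ^ d) N / poch (q ^ d) (q ^ d) N / (q ^ r) ^ N) *
        (∑ k ∈ range (N + 1), term d r k - ∑ k ∈ range (N + 1), term d r k *
          ((2 - q ^ n) * (1 - q ^ n) ^ 2 * ∑ j ∈ range k,
            (koebe (q ^ r * (q ^ d) ^ j) + koebe (q ^ d * (q ^ d) ^ j)))) ∈ cycIdeal n 5 := by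
  have hlt := H.lt_n
  have hu := cyclotomic_not_isUnit H.n_pos
  have hε := eps_mem H.n_pos
  have W := theta_watson H
  have A : ∑ k ∈ range (N + 1), theta d r k - ∑ k ∈ range (N + 1), theta d r k *
      ∏ j ∈ range k, (1 - (koebe (q ^ r * (q ^ d) ^ j) * ((1 - q ^ n) ^ 2 / q ^ n)) ^ 2) /
        (1 - (koebe (q ^ d * (q ^ d) ^ j) * ((1 - q ^ n) ^ 2 / q ^ n)) ^ 2) ∈ cycIdeal n 5 := by
    -- Order 4 from e^2 and one more from the symmetry.
    have h1 := mul_mem_powIdeal (pow_mem_powIdeal hε 2) (sum_theta_mul_mem H)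
    have h2 : ∑ k ∈ range (N + 1), theta d r k * (∏ j ∈ range k,
        (1 - (koebe (q ^ r * (q ^ d) ^ j) * ((1 - q ^ n) ^ 2 / q ^ n)) ^ 2) /
        (1 - (koebe (q ^ d * (q ^ d) ^ j) * ((1 - q ^ n) ^ 2 / q ^ n)) ^ 2) -
        (1 - ∑ j ∈ range k, ((koebe (q ^ r * (q ^ d) ^ j) * ((1 - q ^ n) ^ 2 / q ^ n)) ^ 2 -
          (koebe (q ^ d * (q ^ d) ^ j) * ((1 - q ^ n) ^ 2 / q ^ n)) ^ 2))) ∈ cycIdeal n 5 := by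
      refine sum_mem fun k hk => ?_
      have hk := mem_range.1 hk
      refine mul_mem_powIdeal_left (theta_mem H (by omega)) (powIdeal_mono (e := 8) (by norm_num) ?_)
      refine prod_div_sub_mem (e := 4) hu (by norm_num) k _ _ (fun j hj => ?_) (fun j hj => ?_)
      · exact pow_mem_powIdeal (e := 2)
          (mul_mem_powIdeal_left (koebe_r_mem H (by omega)) hε) 2
      · exact pow_mem_powIdeal (e := 2)
          (mul_mem_powIdeal_left (koebe_d_mem H (by omega)) hε) 2
    convert sub_mem h1 h2 using 1
    rw [← sum_sub_distrib, mul_sum, ← sum_sub_distrib]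
    refine sum_congr rfl fun k _ => ?_
    simp only [mul_pow _ ((1 - q ^ n) ^ 2 / q ^ n), ← sub_mul, ← sum_mul]
    ring
  have B : ∑ k ∈ range (N + 1), term d r k *
        ∏ j ∈ range k, (1 - koebe (q ^ r * (q ^ d) ^ j) * ((1 - q ^ n) ^ 2 / q ^ n)) /
          (1 - -(koebe (q ^ d * (q ^ d) ^ j) * ((1 - q ^ n) ^ 2 / q ^ n))) -
        (∑ k ∈ range (N + 1), term d r k - ∑ k ∈ range (N + 1), term d r k *
          ((2 - q ^ n) * (1 - q ^ n) ^ 2 * ∑ j ∈ range k,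
            (koebe (q ^ r * (q ^ d) ^ j) + koebe (q ^ d * (q ^ d) ^ j)))) ∈ cycIdeal n 4 := by
    rw [← sum_sub_distrib, ← sum_sub_distrib]
    refine sum_mem fun k hk => ?_
    have hk := mem_range.1 hk
    have h1 := prod_div_sub_mem (e := 2) hu (by norm_num) k
      (fun j => koebe (q ^ r * (q ^ d) ^ j) * ((1 - q ^ n) ^ 2 / q ^ n))
      (fun j => -(koebe (q ^ d * (q ^ d) ^ j) * ((1 - q ^ n) ^ 2 / q ^ n)))
      (fun j hj => mul_mem_powIdeal_left (koebe_r_mem H (by omega)) hε)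
      (fun j hj => neg_mem (mul_mem_powIdeal_left (koebe_d_mem H (by omega)) hε))
    have h2 := mul_mem_powIdeal_left (sum_koebe_mem H (k := k) (by omega)) (eps_sub_mem H.n_pos)
    have h3 := mul_mem_powIdeal_left (term_mem H (k := k) (by omega)) (sub_mem h1 h2)
    convert h3 using 1
    simp only [sub_neg_eq_add, ← add_mul, ← sum_mul]
    ring
  -- The balanced series is needed only to order 4, as [n] supplies the fifth power.
  have C := mul_mem_powIdeal (mul_mem_powIdeal_right (qInt_self_mem H.one_lt_n) (prefactor_mem H)) B
  rw [W] at A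
  convert add_mem A C using 1
  ring

lemma corr_eq (k : ℕ) : corr d m n r k = 1 - m * ((2 - q ^ n) * (1 - q ^ n) ^ 2 *
    ∑ j ∈ range k, (koebe (q ^ r * (q ^ d) ^ j) + koebe (q ^ d * (q ^ d) ^ j))) := by
  have hq1 : 1 - q ≠ 0 := by simpa using q_pow_ne_one one_ne_zero
  have key : ∀ a : ℕ, q ^ a / qInt a ^ 2 = koebe (q ^ a) * (1 - q) ^ 2 := fun a => by
    rw [qInt_natCast, koebe, div_pow, div_div_eq_mul_div]; ring
  have hs : ∑ t ∈ Icc 1 k, (q ^ ((d : ℤ) * t - d + r) / qInt ((d : ℤ) * t - d + r) ^ 2 +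
        q ^ (d * t) / qInt ((d : ℤ) * t) ^ 2) =
      (∑ j ∈ range k, (koebe (q ^ r * (q ^ d) ^ j) + koebe (q ^ d * (q ^ d) ^ j))) *
        (1 - q) ^ 2 := by
    induction k with
    | zero => simp
    | succ k ih =>
      rw [sum_Icc_succ_top (by omega), ih, sum_range_succ]
      have e1 : (d : ℤ) * ((k + 1 : ℕ) : ℤ) - d + r = ((r + d * k : ℕ) : ℤ) := by push_cast; ring
      have e2 : (d : ℤ) * ((k + 1 : ℕ) : ℤ) = ((d * (k + 1) : ℕ) : ℤ) := by push_cast; ring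
      rw [e1, e2, zpow_natCast, key, key, q_mul_pow, q_mul_pow, mul_add d k 1, mul_one,
        add_comm (d * k) d]
      ring
  rw [corr, hs, qInt_natCast]
  field_simp

/-- First order expansion of a power. -/
lemma sub_pow_sub_mem {P : Polynomial ℚ} {e : ℕ} {T x : RatFunc ℚ} (hT : T ∈ localRing P)
    (hx : x ∈ powIdeal P e) (k : ℕ) :
    (T - x) ^ (k + 1) - T ^ k * (T - (k + 1 : ℕ) * x) ∈ powIdeal P (2 * e) := by
  induction k with
  | zero => simp [zero_mem]
  | succ k ih =>
    have h1 := mul_mem_powIdeal_right ih (sub_mem hT (powIdeal_le_localRing hx))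
    have h2 := mul_mem_powIdeal_left
      (mul_mem (pow_mem hT k) (natCast_mem (localRing P) (k + 1))) (mul_mem_powIdeal hx hx)
    rw [two_mul] at *
    convert add_mem h1 h2 using 1
    push_cast
    ring

theorem multiSum_congr (H : Admissible d n r N) (hm : 2 ≤ m) (hmd : m ≤ d) :
    multiSum d m n r -
      (qInt n * (poch ((q ^ r) ^ 2) (q ^ d) N / poch (q ^ d) (q ^ d) N / (q ^ r) ^ N)) ^ m *
        (∑ k ∈ range (N + 1), term d r k) ^ (m - 1) *
        ∑ k ∈ range (N + 1), term d r k * corr d m n r k ∈ cycIdeal n 6 := by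
  have h1 := multiSum_sub_mem H hmd
  have h2 := sum_theta_sub_mem H
  have hx : ∑ k ∈ range (N + 1), term d r k *
          ((2 - q ^ n) * (1 - q ^ n) ^ 2 * ∑ j ∈ range k,
            (koebe (q ^ r * (q ^ d) ^ j) + koebe (q ^ d * (q ^ d) ^ j))) ∈ cycIdeal n 2 :=
    sum_mem fun k hk => by
      have hk := mem_range.1 hk
      exact mul_mem_powIdeal_left (term_mem H (by omega))
        (mul_mem_powIdeal_right (delta_mem n) (sum_koebe_mem H (by omega)))
  have e : ∑ k ∈ range (N + 1), term d r k * corr d m n r k =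
      ∑ k ∈ range (N + 1), term d r k - m * ∑ k ∈ range (N + 1), term d r k *
          ((2 - q ^ n) * (1 - q ^ n) ^ 2 * ∑ j ∈ range k,
            (koebe (q ^ r * (q ^ d) ^ j) + koebe (q ^ d * (q ^ d) ^ j))) := by
    rw [mul_sum, ← sum_sub_distrib]
    refine sum_congr rfl fun k _ => ?_
    rw [corr_eq]; ring
  rw [e]
  have hT := sum_term_mem H
  have hC := mul_mem_powIdeal_right (qInt_self_mem H.one_lt_n) (prefactor_mem H)
  generalize ∑ k ∈ range (N + 1), term d r k *
          ((2 - q ^ n) * (1 - q ^ n) ^ 2 * ∑ j ∈ range k,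
            (koebe (q ^ r * (q ^ d) ^ j) + koebe (q ^ d * (q ^ d) ^ j))) = x at *
  generalize ∑ k ∈ range (N + 1), term d r k = T at *
  generalize ∑ k ∈ range (N + 1), theta d r k = S at *
  generalize qInt n * (poch ((q ^ r) ^ 2) (q ^ d) N / poch (q ^ d) (q ^ d) N / (q ^ r) ^ N) = C at *
  have hY : C * (T - x) ∈ cycIdeal n 1 :=
    mul_mem_powIdeal_right hC (sub_mem hT (powIdeal_le_localRing hx))
  have hS : S ∈ cycIdeal n 1 := by
    have := add_mem (powIdeal_mono (by norm_num) h2) hY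
    rwa [sub_add_cancel] at this
  -- Precision 5 = 4 + 1 for the base becomes 4 + m ≥ 6 for the m-th power.
  have h3 := pow_sub_pow_mem_of_dvd (Polynomial.cyclotomic_ne_zero n ℚ) h2 hS hY m
  obtain ⟨k, rfl⟩ : ∃ k, m = k + 1 := ⟨m - 1, by omega⟩
  -- The terms quadratic in x have order 4, and C^m supplies m further powers.
  have h4 := mul_mem_powIdeal (pow_mem_powIdeal hC (k + 1)) (sub_pow_sub_mem hT hx k)
  rw [Nat.add_sub_cancel]
  convert add_mem (add_mem h1 (powIdeal_mono (f := 6) (by omega) h3))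
    (powIdeal_mono (f := 6) (by omega) h4) using 1
  rw [mul_pow]; ring

end Conclusion

end QSuper

theorem mainTheorem1 (d m n r : ℕ) (hd : 0 < d) (hn : 0 < n) (hr : 0 < r)
    (hrn : r ≤ n) (hmod : n ≡ r [MOD d]) (hcop : Nat.Coprime r d)
    (hm : 2 ≤ m) (hmd : m ≤ d) :
    QSuper.RatCongr (Polynomial.cyclotomic n ℚ ^ 6)
      (QSuper.multiSum d m n r)
      (QSuper.qInt n ^ m *
        QSuper.q ^ (((m : ℤ) * (r : ℤ) * ((r : ℤ) - (n : ℤ))) / (d : ℤ)) *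
        (QSuper.qPoch (QSuper.q ^ (2 * r)) (QSuper.q ^ d) ((n - r) / d) ^ m /
          QSuper.qPoch (QSuper.q ^ d) (QSuper.q ^ d) ((n - r) / d) ^ m) *
        (∑ k ∈ Finset.range ((n - r) / d + 1), QSuper.term d r k) ^ (m - 1) *
        ∑ k ∈ Finset.range ((n - r) / d + 1),
          QSuper.term d r k * QSuper.corr d m n r k) := by
  open QSuper in
  obtain ⟨N, hN⟩ : d ∣ n - r := (Nat.modEq_iff_dvd' hrn).1 hmod.symm
  have hdiv : (n - r) / d = N := by rw [hN, Nat.mul_div_cancel_left _ hd]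
  rw [hdiv]
  have hnr : r + d * N = n := by omega
  apply ratCongr_of_mem
  rcases Nat.lt_or_ge 1 n with h1 | h1
  · have H : Admissible d n r N := by
      refine ⟨h1, hr, by omega, hnr, ?_⟩
      rw [← hnr]
      simpa using hcop
    convert multiSum_congr H hm hmd using 4
    -- The integer division is exact, because n - r = dN.
    have e : ((m : ℤ) * (r : ℤ) * ((r : ℤ) - (n : ℤ))) / (d : ℤ) = -((r * N * m : ℕ) : ℤ) := by
      have : (m : ℤ) * (r : ℤ) * ((r : ℤ) - (n : ℤ)) = -((r * N * m : ℕ) : ℤ) * d := by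
        rw [← hnr]; push_cast; ring
      rw [this, Int.mul_ediv_cancel _ (by omega)]
    rw [e, zpow_neg, zpow_natCast, qPoch_eq, qPoch_eq, pow_mul q (r * N) m, pow_mul q r N,
      ← pow_mul q r 2, mul_comm r 2]
    simp only [div_eq_mul_inv, mul_pow, inv_pow]
    ring
  -- For n = 1 the element 1 - q is not a unit at Φ_1, so the general argument does not apply; here
  -- r = 1 and N = 0, and both sides equal 1.
  · obtain rfl : n = 1 := by omega
    obtain rfl : r = 1 := by omega
    obtain rfl : N = 0 := by
      rcases Nat.eq_zero_or_pos N with h | h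
      · exact h
      · have := Nat.mul_pos hd h
        omega
    have hq1 : 1 - q ≠ 0 := by simpa using q_pow_ne_one one_ne_zero
    have h : multiSum d m 1 1 = 1 := by
      have : (Fintype.piFinset fun _ : Fin m => range 1) = {fun _ => 0} := by
        ext i
        simp [funext_iff]
      rw [multiSum, this, filter_singleton]
      simp [theta, qInt, qPoch, hq1]
    rw [h]
    simp [term, corr, qPoch, qInt, hq1, zero_mem]
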